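/- Let $d\ge 1$, $\tau>d/2$, $c_\Phi>0$, $\nu>0$ and $c_q,b\in\mathbb R$. Put $$M_d=12\Big(\tfrac{\pi\,\Gamma(\frac d2+1)^2}{9}\Big)^{\frac1{d+1}},\qquad C_d=\frac{1}{2\Gamma(\frac d2+1)}\Big(\frac{M_d}{2^{3/2}}\Big)^d .$$ Then there is $\theta>0$, depending only on $d,\tau,c_\Phi,\nu,c_q,b$, such that the following holds. Let $\Phi:\mathbb R^d\to\mathbb R$ be continuous and radial with $\operatorname{supp}\Phi\subset\{\|x\|_2\le 1\}$, $\Phi(0)\le b$, and $$c_\Phi(1+\|\omega\|_2^2)^{-\tau}\le\widehat\Phi(\omega)\le C_\Phi(1+\|\omega\|_2^2)^{-\tau}\quad(\omega\in\mathbb R^d)$$ for some $C_\Phi>0$, where $\widehat\Phi(\omega)=(2\pi)^{-d/2}\int_{\mathbb R^d}\Phi(x)e^{-i\langle x,\omega\rangle}\,dx$. Put $\Phi_\delta(x)=\delta^{-d}\Phi(x/\delta)$. Let $\Omega\subset\mathbb R^d$ be bounded with nonempty interior (for example a bounded domain), let $L\in\mathbb N$, and for $1\le\ell\le L$ let $X_\ell=\{x^{(\ell)}_1,\dots,x^{(\ell)}_{N(\ell)}\}\subset\Omega$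 consist of $N(\ell)$ distinct points. Denote by $h_\ell=\sup_{y\in\Omega}\min_j\|y-x^{(\ell)}_j\|_2$ its fill distance and by $q_\ell=\frac12\min_{j\ne k}\|x^{(\ell)}_j-x^{(\ell)}_k\|_2$ its separation distance, and assume $$q_\ell\le h_\ell\le c_q\,q_\ell\qquad(1\le\ell\le L).$$ Put $\delta_\ell=\nu h_\ell$ and $A_\ell=\big(\Phi_{\delta_\ell}(x^{(\ell)}_i-x^{(\ell)}_j)\big)_{i,j=1}^{N(\ell)}$. Then for every $1\le\ell\le L$ the matrix $A_\ell$ is invertible, for all $1\le i,j\le N(\ell)$ $$\big|(A_\ell^{-1})_{i,j}\big|\le 2(C_dc_\Phi)^{-1}\big(1+4M_d^2\nu^2c_q^2\big)^{\tau}\,e^{2\theta\sqrt d}\,q_\ell^{d}\,e^{-\theta\|x^{(\ell)}_i-x^{(\ell)}_j\|_2/q_\ell},$$ and the Lagrange basis functions $\chi^{(\ell)}_i(x)=\sum_{k}(A_\ell^{-1})_{i,k}\,\Phi_{\delta_\ell}(x-x^{(\ell)}_k)$ satisfy, for all $1\le i\le N(\ell)$ and all $x\in\mathbb R^d$, $$\big|\chi^{(\ell)}_i(x)\big|\le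 2\,\Phi(0)\,(C_dc_\Phi)^{-1}\big(1+4M_d^2\nu^2c_q^2\big)^{\tau}\,e^{2\theta\sqrt d}\,e^{c_q\nu\theta}\,(1+\nu c_q)^{d}\,e^{-\theta\|x^{(\ell)}_i-x\|_2/q_\ell}.$$ -/

import Mathlib

open scoped FourierTransform

namespace MultiscaleKernel

/-- `ℝ^d` with the Euclidean norm. -/
abbrev E (d : ℕ) : Type := EuclideanSpace ℝ (Fin d)

/-- The Fourier transform `(2π)^(-d/2) ∫ Φ(x) e^(-i⟨x,ω⟩) dx` in the unitary normalization with
angular frequency, expressed through Mathlib's `𝓕`, whose kernel is `e^(-2πi⟨x,ξ⟩)`.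
The real part loses nothing for radial `Φ`, whose transform is real. -/
noncomputable def angularFourier {d : ℕ} (Φ : E d → ℝ) (ω : E d) : ℝ :=
  (2 * Real.pi) ^ (-(d : ℝ) / 2) * (𝓕 (fun x : E d => (Φ x : ℂ)) ((2 * Real.pi)⁻¹ • ω)).re

/-- The assumptions on the kernel: a continuous radial function, supported in the closed unit ball,
whose Fourier transform is bounded below and above by multiples of `(1 + ‖ω‖²)^(-τ)`, `τ > d/2`. -/
structure IsAdmissibleKernel (d : ℕ) (τ cΦ CΦ : ℝ) (Φ : E d → ℝ) : Prop where
  smoothness : (d : ℝ) / 2 < τ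
  lower_pos : 0 < cΦ
  upper_pos : 0 < CΦ
  continuous : Continuous Φ
  radial : ∃ φ : ℝ → ℝ, ∀ x, Φ x = φ ‖x‖
  support_subset : tsupport Φ ⊆ Metric.closedBall 0 1
  fourier_lower : ∀ ω : E d, cΦ * (1 + ‖ω‖ ^ 2) ^ (-τ) ≤ angularFourier Φ ω
  fourier_upper : ∀ ω : E d, angularFourier Φ ω ≤ CΦ * (1 + ‖ω‖ ^ 2) ^ (-τ)

/-- The scaled kernel `Φ_δ(x) = δ^(-d) Φ(x/δ)`. -/
noncomputable def scaledKernel {d : ℕ} (Φ : E d → ℝ) (δ : ℝ) (x : E d) : ℝ :=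
  (δ ^ d)⁻¹ * Φ (δ⁻¹ • x)

/-- The fill distance `sup_{y ∈ Ω} min_{x ∈ X} ‖y - x‖` (for `Ω` bounded, `X` finite nonempty). -/
noncomputable def fillDistance {d : ℕ} (Ω X : Set (E d)) : ℝ :=
  ⨆ y : Ω, Metric.infDist (y : E d) X

/-- The separation distance: half the least distance of two distinct points of `X`. -/
noncomputable def separationDistance {d : ℕ} (X : Set (E d)) : ℝ :=
  X.infsep / 2

/-- The interpolation matrix `(Φ_δ(x_i - x_j))_{i,j}`. -/
noncomputable def kernelMatrix {d n : ℕ} (Φ : E d → ℝ) (δ : ℝ) (x : Fin n → E d) :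
    Matrix (Fin n) (Fin n) ℝ :=
  Matrix.of fun i j => scaledKernel Φ δ (x i - x j)

/-- The Lagrange function `χ_i = ∑_k (A⁻¹)_{ik} Φ_δ(· - x_k)`, `A` being the interpolation matrix. -/
noncomputable def lagrangeFunction {d n : ℕ} (Φ : E d → ℝ) (δ : ℝ) (x : Fin n → E d)
    (i : Fin n) (y : E d) : ℝ :=
  ∑ k, (kernelMatrix Φ δ x)⁻¹ i k * scaledKernel Φ δ (y - x k)

/-- Once the interpolation matrix of a radial kernel is invertible, the functions above are the
cardinal functions: `χ_i(x_m) = δ_{im}`. -/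
theorem lagrangeFunction_node {d n : ℕ} (Φ : E d → ℝ) (hΦ : ∃ φ : ℝ → ℝ, ∀ x, Φ x = φ ‖x‖)
    (δ : ℝ) (x : Fin n → E d) (hA : IsUnit (kernelMatrix Φ δ x).det) (i m : Fin n) :
    lagrangeFunction Φ δ x i (x m) = if i = m then 1 else 0 := by
  obtain ⟨φ, hφ⟩ := hΦ
  have h := congrFun (congrFun (Matrix.nonsing_inv_mul _ hA) i) m
  rw [Matrix.mul_apply, Matrix.one_apply] at h
  rw [← h]
  refine Finset.sum_congr rfl fun k _ => ?_
  simp only [kernelMatrix, Matrix.of_apply, scaledKernel, hφ, norm_smul, norm_sub_rev (x m)]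

/-- `M_d = 12 (π Γ(d/2+1)² / 9)^(1/(d+1))`. -/
noncomputable def constM (d : ℕ) : ℝ :=
  12 * (Real.pi * Real.Gamma ((d : ℝ) / 2 + 1) ^ 2 / 9) ^ (1 / ((d : ℝ) + 1))

/-- `C_d = (M_d / 2^(3/2))^d / (2 Γ(d/2+1))`. -/
noncomputable def constC (d : ℕ) : ℝ :=
  1 / (2 * Real.Gamma ((d : ℝ) / 2 + 1)) * (constM d / (2 : ℝ) ^ ((3 : ℝ) / 2)) ^ d

/-- `(C_d c_Φ)⁻¹ (1 + 4 M_d² ν² c_q²)^τ`. -/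
noncomputable def constK (d : ℕ) (τ cΦ ν cq : ℝ) : ℝ :=
  (constC d * cΦ)⁻¹ * (1 + 4 * constM d ^ 2 * ν ^ 2 * cq ^ 2) ^ τ

end MultiscaleKernel

/-! ### Fourier representation and positive definiteness of the kernel -/

namespace MultiscaleKernel

open MeasureTheory

/-! The matrix `A` is a symmetric band matrix, because `Φ_δ` vanishes beyond distance `δ`, and its
quadratic form lies between `λ` and `κλ` times the squared norm, with `κ` controlled by the data.
The inverse of such a matrix decays exponentially off the diagonal.

Lower bound (`constC_mul_le_sum`). By inversion `Φ` is the transform of its own nonnegative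
transform, so a pointwise minorant of that transform minorizes the quadratic form. The minorant is a
multiple of a difference of two Gaussians that is nonpositive outside a ball. Relative to the
separation distance the transforms of these Gaussians are so narrow that their matrices are close to
the identity (`sum_gaussian_le`). After scaling this gives `λ = (K q^d)⁻¹` with `K = constK`.

Upper bound. A packing count limits the nonzero entries in a row, each at most `δ^(-d) Φ(0)`, and
the Schur test applies.

Decay (`abs_inv_apply_le_of_band`). With `B = 1 - A/Λ` one has `A⁻¹ = Λ⁻¹ ∑_{k<n} B^k + A⁻¹ B^n`.
For `n = ⌈‖x_i - x_j‖/δ⌉` the sum has zero `(i,j)` entry, and the remainder is at most `λ⁻¹ (1 -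
λ/Λ)^n`. The bound on a Lagrange function follows by summing over the few nodes within `δ` of the
point. If `δ < 2q`, the matrix is a multiple of the identity and is treated directly.

The upper Fourier bound serves only to make the transform integrable, hence `θ` does not depend on
`C_Φ`. -/

theorem re_fourier_eq_integral {d : ℕ} {f : E d → ℝ} (hf : Integrable f) (w : E d) :
    (𝓕 (fun x : E d => (f x : ℂ)) w).re = ∫ v, f v * Real.cos (2 * Real.pi * inner ℝ v w) := by
  have hfc : Integrable (fun x : E d => (f x : ℂ)) := hf.ofReal
  have hint := (Real.fourierIntegral_convergent_iff (μ := volume) w).2 hfc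
  rw [Real.fourier_eq]
  have h := integral_re hint
  simp only [RCLike.re_to_complex] at h
  rw [← h]
  refine integral_congr_ae (Filter.Eventually.of_forall fun v => ?_)
  simp only [Circle.smul_def, Real.fourierChar_apply, smul_eq_mul, Complex.re_mul_ofReal,
    Complex.exp_ofReal_mul_I_re]
  rw [mul_comm, mul_neg, Real.cos_neg]

/-- Both sides equal `|∑ c_j e^(i t_j)|²`. -/
theorem sum_mul_cos_sub {ι : Type*} [Fintype ι] (c t : ι → ℝ) :
    ∑ i, ∑ j, c i * c j * Real.cos (t i - t j)
      = (∑ i, c i * Real.cos (t i)) ^ 2 + (∑ i, c i * Real.sin (t i)) ^ 2 := by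
  simp only [sq, Finset.sum_mul_sum, ← Finset.sum_add_distrib]
  refine Finset.sum_congr rfl fun i _ => Finset.sum_congr rfl fun j _ => ?_
  rw [Real.cos_sub]
  ring

/-- The easy half of Bochner's theorem. -/
theorem sum_re_fourier_nonneg {d : ℕ} {ι : Type*} [Fintype ι] {f : E d → ℝ} (hf : Integrable f)
    (h0 : ∀ ξ, 0 ≤ f ξ) (z : ι → E d) (c : ι → ℝ) :
    0 ≤ ∑ i, ∑ j, c i * c j * (𝓕 (fun x : E d => (f x : ℂ)) (z i - z j)).re := by
  have hint : ∀ w : E d, Integrable fun v => f v * Real.cos (2 * Real.pi * inner ℝ v w) :=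
    fun w => hf.mul_bdd (c := 1)
      (Continuous.aestronglyMeasurable (by fun_prop))
      (Filter.Eventually.of_forall fun v => by
        simpa using Real.abs_cos_le_one _)
  simp_rw [re_fourier_eq_integral hf, ← integral_const_mul]
  have : ∑ i, ∑ j, ∫ v, c i * c j * (f v * Real.cos (2 * Real.pi * inner ℝ v (z i - z j)))
      = ∫ v, ∑ i, ∑ j, c i * c j * (f v * Real.cos (2 * Real.pi * inner ℝ v (z i - z j))) := by
    rw [integral_finsetSum _ fun i _ => integrable_finsetSum _ fun j _ => (hint _).const_mul _]
    refine Finset.sum_congr rfl fun i _ => ?_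
    rw [integral_finsetSum _ fun j _ => (hint _).const_mul _]
  rw [this]
  refine integral_nonneg fun v => ?_
  have h2 : ∑ i, ∑ j, c i * c j * (f v * Real.cos (2 * Real.pi * inner ℝ v (z i - z j)))
      = f v * ∑ i, ∑ j, c i * c j * Real.cos
        ((2 * Real.pi * inner ℝ v (z i)) - (2 * Real.pi * inner ℝ v (z j))) := by
    simp only [Finset.mul_sum]
    refine Finset.sum_congr rfl fun i _ => Finset.sum_congr rfl fun j _ => ?_
    rw [inner_sub_right, mul_sub]
    ring
  simp only [Pi.zero_apply]
  rw [h2, sum_mul_cos_sub]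
  exact mul_nonneg (h0 v) (by positivity)

theorem re_fourier_gaussian {d : ℕ} {a : ℝ} (ha : 0 < a) (w : E d) :
    (𝓕 (fun x : E d => ((Real.exp (-a * ‖x‖ ^ 2) : ℝ) : ℂ)) w).re
      = (Real.pi / a) ^ ((d : ℝ) / 2) * Real.exp (-Real.pi ^ 2 * ‖w‖ ^ 2 / a) := by
  have h := fourier_gaussian_innerProductSpace (V := E d) (b := (a : ℂ)) (by simpa using ha) w
  have h1 : (fun x : E d => ((Real.exp (-a * ‖x‖ ^ 2) : ℝ) : ℂ))
      = fun x : E d => Complex.exp (-(a : ℂ) * (‖x‖ : ℂ) ^ 2) := by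
    ext x; push_cast; rfl
  rw [h1, h]
  have h2 : ((Real.pi : ℂ) / a) ^ ((Module.finrank ℝ (E d) : ℂ) / 2)
      = (((Real.pi / a) ^ ((d : ℝ) / 2) : ℝ) : ℂ) := by
    rw [Complex.ofReal_cpow (by positivity)]
    simp
  rw [h2, Complex.re_ofReal_mul]
  congr 1
  rw [← Complex.exp_ofReal_re]
  congr 2
  push_cast; rfl

theorem integrable_gaussian {d : ℕ} {a : ℝ} (ha : 0 < a) :
    Integrable fun x : E d => Real.exp (-a * ‖x‖ ^ 2) := by
  have h := GaussianFourier.integrable_cexp_neg_mul_sq_norm_add (V := E d) (b := (a : ℂ))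
    (by simpa using ha) 0 0
  refine h.re.congr (Filter.Eventually.of_forall fun x => ?_)
  simp only [RCLike.re_to_complex]
  rw [← Complex.exp_ofReal_re]
  simp

variable {d : ℕ} {τ cΦ CΦ : ℝ} {Φ : E d → ℝ}

namespace IsAdmissibleKernel

theorem map_neg (h : IsAdmissibleKernel d τ cΦ CΦ Φ) (x : E d) : Φ (-x) = Φ x := by
  obtain ⟨φ, hφ⟩ := h.radial
  rw [hφ, hφ, norm_neg]

theorem eq_zero_of_one_lt_norm (h : IsAdmissibleKernel d τ cΦ CΦ Φ) {x : E d} (hx : 1 < ‖x‖) :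
    Φ x = 0 := by
  by_contra hne
  have := h.support_subset (subset_tsupport _ hne)
  simp at this
  linarith

theorem integrable (h : IsAdmissibleKernel d τ cΦ CΦ Φ) : Integrable Φ :=
  h.continuous.integrable_of_hasCompactSupport
    (HasCompactSupport.of_support_subset_isCompact (isCompact_closedBall 0 1)
      ((subset_tsupport _).trans h.support_subset))

theorem exponent_pos (h : IsAdmissibleKernel d τ cΦ CΦ Φ) : 0 < τ :=
  lt_of_le_of_lt (by positivity) h.smoothness

/-- Conjugation flips the sign in the exponential; the substitution `v ↦ -v` undoes it because `Φ`
is even. -/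
theorem fourier_eq_ofReal (h : IsAdmissibleKernel d τ cΦ CΦ Φ) (ξ : E d) :
    𝓕 (fun x : E d => (Φ x : ℂ)) ξ = ((𝓕 (fun x : E d => (Φ x : ℂ)) ξ).re : ℂ) := by
  symm
  rw [← Complex.conj_eq_iff_re, Real.fourier_eq, ← integral_conj, ← integral_neg_eq_self]
  refine integral_congr_ae (Filter.Eventually.of_forall fun v => ?_)
  simp only [Circle.smul_def, smul_eq_mul, map_mul, h.map_neg, Complex.conj_ofReal, inner_neg_left,
    neg_neg, Real.fourierChar_apply, ← Complex.exp_conj, Complex.conj_I]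
  congr 2
  push_cast
  ring

theorem re_fourier_eq (ξ : E d) :
    (𝓕 (fun x : E d => (Φ x : ℂ)) ξ).re
      = (2 * Real.pi) ^ ((d : ℝ) / 2) * angularFourier Φ ((2 * Real.pi) • ξ) := by
  have hp : (0 : ℝ) < 2 * Real.pi := by positivity
  rw [angularFourier, smul_smul, inv_mul_cancel₀ hp.ne', one_smul, ← mul_assoc,
    ← Real.rpow_add hp]
  ring_nf
  simp

theorem le_re_fourier (h : IsAdmissibleKernel d τ cΦ CΦ Φ) (ξ : E d) :
    (2 * Real.pi) ^ ((d : ℝ) / 2) * cΦ * (1 + (2 * Real.pi * ‖ξ‖) ^ 2) ^ (-τ)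
      ≤ (𝓕 (fun x : E d => (Φ x : ℂ)) ξ).re := by
  have := h.fourier_lower ((2 * Real.pi) • ξ)
  rw [norm_smul, Real.norm_of_nonneg (by positivity)] at this
  rw [re_fourier_eq, mul_assoc]
  gcongr

theorem re_fourier_nonneg (h : IsAdmissibleKernel d τ cΦ CΦ Φ) (ξ : E d) :
    0 ≤ (𝓕 (fun x : E d => (Φ x : ℂ)) ξ).re :=
  le_trans (by have := h.lower_pos; positivity) (h.le_re_fourier ξ)

theorem re_fourier_le (h : IsAdmissibleKernel d τ cΦ CΦ Φ) (ξ : E d) :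
    (𝓕 (fun x : E d => (Φ x : ℂ)) ξ).re
      ≤ (2 * Real.pi) ^ ((d : ℝ) / 2) * CΦ * (1 + ‖ξ‖ ^ 2) ^ (-τ) := by
  have h1 := h.fourier_upper ((2 * Real.pi) • ξ)
  rw [norm_smul, Real.norm_of_nonneg (by positivity)] at h1
  rw [re_fourier_eq, mul_assoc]
  have hC := h.upper_pos
  gcongr
  refine h1.trans ?_
  gcongr CΦ * ?_
  refine Real.rpow_le_rpow_of_nonpos (by positivity) ?_ (by linarith [h.exponent_pos])
  have : (1 : ℝ) ≤ 2 * Real.pi := by linarith [Real.pi_gt_three]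
  gcongr
  exact le_mul_of_one_le_left (norm_nonneg _) this

theorem integrable_re_fourier (h : IsAdmissibleKernel d τ cΦ CΦ Φ) :
    Integrable fun ξ : E d => (𝓕 (fun x : E d => (Φ x : ℂ)) ξ).re := by
  have h1 : Integrable fun ξ : E d => (1 + ‖ξ‖ ^ 2) ^ (-(2 * τ) / 2) :=
    integrable_rpow_neg_one_add_norm_sq (by
      rw [finrank_euclideanSpace_fin]; linarith [h.smoothness])
  have hcont : Continuous (𝓕 (fun x : E d => (Φ x : ℂ))) :=
    VectorFourier.fourierIntegral_continuous Real.continuous_fourierChar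
      (by exact continuous_inner) h.integrable.ofReal
  refine (h1.const_mul ((2 * Real.pi) ^ ((d : ℝ) / 2) * CΦ)).mono'
    (Complex.continuous_re.comp hcont).aestronglyMeasurable
    (Filter.Eventually.of_forall fun ξ => ?_)
  rw [Real.norm_of_nonneg (h.re_fourier_nonneg ξ), show -(2 * τ) / 2 = -τ by ring]
  exact h.re_fourier_le ξ

/-- Evenness turns the inverse transform into a second forward transform. Hence
`sum_re_fourier_nonneg` applies to matrices built from `Φ`. -/
theorem eq_re_fourier_fourier (h : IsAdmissibleKernel d τ cΦ CΦ Φ) (x : E d) :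
    (𝓕 (fun ξ : E d => ((𝓕 (fun x : E d => (Φ x : ℂ)) ξ).re : ℂ)) x).re = Φ x := by
  have h1 : (fun ξ : E d => ((𝓕 (fun x : E d => (Φ x : ℂ)) ξ).re : ℂ))
      = 𝓕 (fun x : E d => (Φ x : ℂ)) := funext fun ξ => (h.fourier_eq_ofReal ξ).symm
  have h2 : Integrable (𝓕 (fun x : E d => (Φ x : ℂ))) := h1 ▸ h.integrable_re_fourier.ofReal
  have h3 := Continuous.fourierInv_fourier_eq (f := fun x : E d => (Φ x : ℂ))
    (Complex.continuous_ofReal.comp h.continuous) h.integrable.ofReal h2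
  have h4 := congrFun h3 (-x)
  rw [Real.fourierInv_eq_fourier_neg, neg_neg, h.map_neg] at h4
  rw [h1, h4, Complex.ofReal_re]

end IsAdmissibleKernel

end MultiscaleKernel

/-! ### Packing, Gaussian row sums, the Schur test, and bounds for `Γ` and `M_d` -/

namespace MultiscaleKernel

open MeasureTheory

/-- Packing bound for a family of points with pairwise distances at least `2 * s`. -/
theorem card_le_of_separated {d : ℕ} {ι : Type*} {z : ι → E d} {s : ℝ} (hs : 0 < s)
    (hz : ∀ i j, i ≠ j → 2 * s ≤ ‖z i - z j‖) (y : E d) {r : ℝ} (hr : 0 ≤ r) (T : Finset ι)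
    (hT : ∀ k ∈ T, ‖y - z k‖ ≤ r) : (T.card : ℝ) ≤ (1 + r / s) ^ d := by
  -- Disjoint balls of radius `s` about the points lie in the ball of radius `r + s` about `y`;
  -- volumes are compared.
  have hdisj : (T : Set ι).PairwiseDisjoint fun k => Metric.ball (z k) s := by
    intro i _ j _ hij
    refine Metric.ball_disjoint_ball ?_
    rw [dist_eq_norm]
    linarith [hz i j hij]
  have hsub : (⋃ k ∈ T, Metric.ball (z k) s) ⊆ Metric.ball y (r + s) := by
    refine Set.iUnion₂_subset fun k hk => Metric.ball_subset_ball' ?_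
    rw [dist_comm, dist_eq_norm]
    linarith [hT k hk]
  have h := measure_mono (μ := volume) hsub
  rw [measure_biUnion_finset hdisj fun k _ => measurableSet_ball] at h
  simp only [Measure.addHaar_ball_of_pos volume _ hs,
    Measure.addHaar_ball_of_pos volume y (show 0 < r + s by positivity), Finset.sum_const,
    nsmul_eq_mul, finrank_euclideanSpace_fin, ← mul_assoc] at h
  rw [ENNReal.mul_le_mul_iff_left (Metric.measure_ball_pos volume _ one_pos).ne' measure_ball_lt_top.ne,
    ← ENNReal.ofReal_natCast, ← ENNReal.ofReal_mul (by positivity),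
    ENNReal.ofReal_le_ofReal_iff (by positivity)] at h
  have h2 : 1 + r / s = (r + s) / s := by field_simp; ring
  rw [h2, div_pow, le_div_iff₀ (by positivity)]
  exact h

theorem two_mul_add_five_le (m : ℕ) : (2 * m + 5 : ℝ) ≤ 5 ^ (m + 1) := by
  induction m with
  | zero => norm_num
  | succ k ih => rw [pow_succ]; push_cast; nlinarith [(Nat.cast_nonneg k : (0 : ℝ) ≤ k)]

theorem exp_neg_two_lt : Real.exp (-2) < 0.1354 := by
  have h := Real.exp_one_gt_d9
  rw [Real.exp_neg, show (2 : ℝ) = 1 + 1 by norm_num, Real.exp_add]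
  rw [inv_lt_comm₀ (by positivity) (by norm_num)]
  nlinarith

/-- The worst case `X = (d+1)/2` gives `(5e⁻²)^d e⁻² ≤ 5e⁻⁴ < 1/10`. -/
theorem five_pow_mul_exp_le {d : ℕ} (hd : 1 ≤ d) {X : ℝ} (hX : ((d : ℝ) + 1) / 2 ≤ X) :
    5 ^ d * Real.exp (-4 * X) ≤ 1 / 10 := by
  have h1 : Real.exp (-4 * X) ≤ Real.exp (-2) ^ d * Real.exp (-2) := by
    rw [← Real.exp_nat_mul, ← Real.exp_add]
    exact Real.exp_le_exp.2 (by linarith)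
  have h2 := exp_neg_two_lt
  have h3 : (5 * Real.exp (-2)) ^ d ≤ 5 * Real.exp (-2) :=
    pow_le_of_le_one (by positivity) (by linarith) (by omega)
  calc 5 ^ d * Real.exp (-4 * X) ≤ 5 ^ d * (Real.exp (-2) ^ d * Real.exp (-2)) := by gcongr
    _ = (5 * Real.exp (-2)) ^ d * Real.exp (-2) := by rw [mul_pow]; ring
    _ ≤ 5 * Real.exp (-2) * Real.exp (-2) := by gcongr
    _ ≤ 1 / 10 := by nlinarith [Real.exp_pos (-2)]

/-- Split into shells `2(m+1) ≤ ‖z i - z j‖/s ≤ 2(m+2)`. Packing allows at most `(2m+5)^d ≤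
5^(d(m+1))` points in shell `m`, each contributing at most `e^(-4X(m+1))`, so the shell contributes
at most `10^(-(m+1))`; these sum to `1/9`. -/
theorem sum_gaussian_le {d : ℕ} (hd : 1 ≤ d) {ι : Type*} [Fintype ι] [DecidableEq ι]
    {z : ι → E d} {s : ℝ} (hs : 0 < s) (hz : ∀ i j, i ≠ j → 2 * s ≤ ‖z i - z j‖) {X : ℝ}
    (hX : ((d : ℝ) + 1) / 2 ≤ X) (i : ι) :
    ∑ j ∈ Finset.univ.erase i, Real.exp (-X * (‖z i - z j‖ / s) ^ 2) ≤ 1 / 9 := by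
  have hX0 : 0 < X := lt_of_lt_of_le (by positivity) hX
  -- For `j ≠ i` the floor is at least `1`, so the truncated subtraction is exact and the shells are
  -- numbered from `0`.
  let n : ι → ℕ := fun j => ⌊‖z i - z j‖ / (2 * s)⌋₊ - 1
  have hn : ∀ j ∈ Finset.univ.erase i, 2 * ((n j : ℝ) + 1) ≤ ‖z i - z j‖ / s ∧
      ‖z i - z j‖ / s ≤ 2 * ((n j : ℝ) + 2) := by
    intro j hj
    have h1 : 1 ≤ ⌊‖z i - z j‖ / (2 * s)⌋₊ := by
      rw [Nat.one_le_floor_iff, le_div_iff₀ (by positivity), one_mul]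
      exact hz i j (Finset.ne_of_mem_erase hj).symm
    have h2 : ((n j : ℕ) : ℝ) = (⌊‖z i - z j‖ / (2 * s)⌋₊ : ℝ) - 1 := by
      simp only [n]; push_cast [Nat.cast_sub h1]; ring
    have h3 := Nat.floor_le (show 0 ≤ ‖z i - z j‖ / (2 * s) by positivity)
    have h4 := (Nat.lt_floor_add_one (‖z i - z j‖ / (2 * s))).le
    have h5 : ‖z i - z j‖ / s = 2 * (‖z i - z j‖ / (2 * s)) := by field_simp
    rw [h2, h5]
    constructor <;> linarith
  rw [← Finset.sum_fiberwise_of_maps_to (t := (Finset.univ.erase i).image n)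
    (fun j hj => Finset.mem_image_of_mem n hj)]
  have hshell : ∀ m : ℕ, ∑ j ∈ Finset.univ.erase i with n j = m,
      Real.exp (-X * (‖z i - z j‖ / s) ^ 2) ≤ (1 / 10) * (1 / 10) ^ m := by
    intro m
    have hcard := card_le_of_separated hs hz (z i) (r := 2 * (m + 2) * s) (by positivity)
      ({j ∈ Finset.univ.erase i | n j = m}) (by
        intro j hj
        rw [Finset.mem_filter] at hj
        rw [← div_le_iff₀ hs, ← hj.2]
        exact (hn j hj.1).2)
    have hterm : ∀ j ∈ ({j ∈ Finset.univ.erase i | n j = m} : Finset ι),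
        Real.exp (-X * (‖z i - z j‖ / s) ^ 2) ≤ Real.exp (-4 * X) ^ (m + 1) := by
      intro j hj
      rw [Finset.mem_filter] at hj
      rw [← Real.exp_nat_mul]
      refine Real.exp_le_exp.2 ?_
      have h1 := (hn j hj.1).1
      rw [hj.2] at h1
      have h2 : (2 * ((m : ℝ) + 1)) ^ 2 ≤ (‖z i - z j‖ / s) ^ 2 := by gcongr
      have h3 : 4 * ((m : ℝ) + 1) ≤ (2 * ((m : ℝ) + 1)) ^ 2 := by
        nlinarith [(Nat.cast_nonneg m : (0 : ℝ) ≤ m)]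
      push_cast
      nlinarith
    refine (Finset.sum_le_card_nsmul _ _ _ hterm).trans ?_
    rw [nsmul_eq_mul]
    have h6 : (1 + 2 * ((m : ℝ) + 2) * s / s) = 2 * m + 5 := by field_simp; ring
    rw [h6] at hcard
    calc _ ≤ ((5 : ℝ) ^ (m + 1)) ^ d * Real.exp (-4 * X) ^ (m + 1) := by
          gcongr
          exact hcard.trans (by gcongr; exact two_mul_add_five_le m)
      _ = (5 ^ d * Real.exp (-4 * X)) ^ (m + 1) := by rw [mul_pow, ← pow_mul, ← pow_mul]; ring
      _ ≤ (1 / 10) ^ (m + 1) := by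
          gcongr
          exact five_pow_mul_exp_le hd hX
      _ = _ := by rw [pow_succ]; ring
  calc _ ≤ ∑ m ∈ (Finset.univ.erase i).image n, (1 / 10 : ℝ) * (1 / 10) ^ m :=
        Finset.sum_le_sum fun m _ => hshell m
    _ = (1 / 10) * ∑ m ∈ (Finset.univ.erase i).image n, (1 / 10 : ℝ) ^ m := by
        rw [Finset.mul_sum]
    _ ≤ (1 / 10) * ∑' m : ℕ, (1 / 10 : ℝ) ^ m := by
        gcongr
        exact (summable_geometric_of_lt_one (by norm_num) (by norm_num)).sum_le_tsum _
          fun _ _ => by positivity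
    _ = 1 / 9 := by rw [tsum_geometric_of_lt_one (by norm_num) (by norm_num)]; norm_num

/-- Schur test for the quadratic form of a symmetric array. -/
theorem abs_sum_le_of_row_sum_le {ι : Type*} [Fintype ι] {G : ι → ι → ℝ}
    (hG : ∀ i j, G i j = G j i) {R : ℝ} (hR : ∀ i, ∑ j, |G i j| ≤ R) (c : ι → ℝ) :
    |∑ i, ∑ j, c i * c j * G i j| ≤ R * ∑ i, c i ^ 2 := by
  have h1 : ∀ i j, |c i * c j * G i j| ≤ c i ^ 2 / 2 * |G i j| + c j ^ 2 / 2 * |G j i| := by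
    intro i j
    rw [abs_mul, hG j i, ← add_mul]
    gcongr
    rw [abs_le]
    constructor <;> nlinarith [sq_nonneg (c i - c j), sq_nonneg (c i + c j)]
  have h2 : ∑ i, ∑ j, c i ^ 2 / 2 * |G i j| ≤ R / 2 * ∑ i, c i ^ 2 := by
    rw [Finset.mul_sum]
    refine Finset.sum_le_sum fun i _ => ?_
    rw [← Finset.mul_sum]
    nlinarith [hR i, sq_nonneg (c i)]
  calc |∑ i, ∑ j, c i * c j * G i j| ≤ ∑ i, ∑ j, |c i * c j * G i j| :=
        (Finset.abs_sum_le_sum_abs _ _).trans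
          (Finset.sum_le_sum fun i _ => Finset.abs_sum_le_sum_abs _ _)
    _ ≤ ∑ i, ∑ j, (c i ^ 2 / 2 * |G i j| + c j ^ 2 / 2 * |G j i|) :=
        Finset.sum_le_sum fun i _ => Finset.sum_le_sum fun j _ => h1 i j
    _ = ∑ i, ∑ j, c i ^ 2 / 2 * |G i j| + ∑ i, ∑ j, c i ^ 2 / 2 * |G i j| := by
        simp only [Finset.sum_add_distrib]
        congr 1
        exact Finset.sum_comm
    _ ≤ R * ∑ i, c i ^ 2 := by linarith

theorem abs_sum_sub_le_of_diag_eq_one {ι : Type*} [Fintype ι] [DecidableEq ι] {G : ι → ι → ℝ}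
    (hG : ∀ i j, G i j = G j i) (h1 : ∀ i, G i i = 1) {S : ℝ}
    (hS : ∀ i, ∑ j ∈ Finset.univ.erase i, |G i j| ≤ S) (c : ι → ℝ) :
    |(∑ i, ∑ j, c i * c j * G i j) - ∑ i, c i ^ 2| ≤ S * ∑ i, c i ^ 2 := by
  have h := abs_sum_le_of_row_sum_le (G := fun i j => G i j - if i = j then 1 else 0) (R := S)
    (fun i j => by simp only [hG i j, eq_comm]) (fun i => by
      rw [← Finset.add_sum_erase _ _ (Finset.mem_univ i)]
      simp only [h1, if_true, sub_self, abs_zero, zero_add]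
      refine le_trans (le_of_eq (Finset.sum_congr rfl fun j hj => ?_)) (hS i)
      rw [if_neg (Finset.ne_of_mem_erase hj).symm, sub_zero]) c
  convert h using 2
  simp only [mul_sub, Finset.sum_sub_distrib]
  congr 1
  simp [sq]

theorem rpow_half_natCast {x : ℝ} (hx : 0 ≤ x) (d : ℕ) : x ^ ((d : ℝ) / 2) = √x ^ d := by
  rw [Real.sqrt_eq_rpow, ← Real.rpow_natCast, ← Real.rpow_mul hx]
  ring_nf

/-- Restrict the Gamma integral to `t ≥ x`, where `t^x ≥ x^x`. -/
theorem rpow_self_mul_exp_neg_le_Gamma {x : ℝ} (hx : 0 < x) :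
    x ^ x * Real.exp (-x) ≤ Real.Gamma (x + 1) := by
  rw [Real.Gamma_eq_integral (by positivity), ← integral_exp_neg_Ioi x, ← integral_const_mul]
  have hint : IntegrableOn (fun t : ℝ => Real.exp (-t) * t ^ (x + 1 - 1)) (Set.Ioi 0) :=
    Real.GammaIntegral_convergent (by positivity)
  have hsub : Set.Ioi x ⊆ Set.Ioi (0 : ℝ) := Set.Ioi_subset_Ioi hx.le
  calc ∫ t in Set.Ioi x, x ^ x * Real.exp (-t)
      ≤ ∫ t in Set.Ioi x, Real.exp (-t) * t ^ (x + 1 - 1) := by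
        refine setIntegral_mono_on ((integrableOn_exp_neg_Ioi x).const_mul _)
          (hint.mono_set hsub) measurableSet_Ioi fun t ht => ?_
        rw [mul_comm, add_sub_cancel_right]
        have : x ≤ t := le_of_lt ht
        gcongr
    _ ≤ ∫ t in Set.Ioi 0, Real.exp (-t) * t ^ (x + 1 - 1) := by
        refine setIntegral_mono_set hint ?_ hsub.eventuallyLE
        filter_upwards [ae_restrict_mem measurableSet_Ioi] with t ht
        have : 0 < t := ht
        simp only [Pi.zero_apply]
        positivity

theorem sqrt_pow_le_Gamma {d : ℕ} (hd : 1 ≤ d) :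
    √((d : ℝ) / (2 * Real.exp 1)) ^ d ≤ Real.Gamma ((d : ℝ) / 2 + 1) := by
  have hd0 : (0 : ℝ) < d := by exact_mod_cast hd
  refine le_trans (le_of_eq ?_) (rpow_self_mul_exp_neg_le_Gamma (x := (d : ℝ) / 2) (by positivity))
  rw [← rpow_half_natCast (by positivity), ← div_div, Real.div_rpow (by positivity) (by positivity),
    Real.exp_one_rpow, Real.exp_neg, div_eq_mul_inv]

theorem sq_le_three_mul_pow {d : ℕ} : (d : ℝ) ^ 2 ≤ 3 * (3 / 2 : ℝ) ^ (d + 1) := by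
  rcases lt_or_ge d 5 with h | h
  · interval_cases d <;> norm_num
  · induction d, h using Nat.le_induction with
    | base => norm_num
    | succ k hk ih =>
      have : (5 : ℝ) ≤ k := by exact_mod_cast hk
      rw [pow_succ (3 / 2 : ℝ)]
      push_cast
      nlinarith

theorem constM_pos (d : ℕ) : 0 < constM d := by
  have := Real.Gamma_pos_of_pos (show 0 < (d : ℝ) / 2 + 1 by positivity)
  rw [constM]
  positivity

theorem constC_pos (d : ℕ) : 0 < constC d := by
  have := Real.Gamma_pos_of_pos (show 0 < (d : ℝ) / 2 + 1 by positivity)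
  have := constM_pos d
  rw [constC]
  positivity

/-- This makes the Gaussian exponent `X = e M_d²/(8d)` at least `(d+1)/2`. Raising to the power
`d+1` removes the root in `M_d`, after which the Stirling-type bound on `Γ` suffices. -/
theorem le_constM_sq {d : ℕ} (hd : 1 ≤ d) :
    4 * d * ((d : ℝ) + 1) / Real.exp 1 ≤ constM d ^ 2 := by
  have hd1 : (1 : ℝ) ≤ d := by exact_mod_cast hd
  have he := Real.exp_one_gt_d9
  have he3 := Real.exp_one_lt_three
  have hπ := Real.pi_gt_three
  set G := Real.Gamma ((d : ℝ) / 2 + 1) with hGdef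
  set e := Real.exp 1 with hedef
  have hG : (d / (2 * e)) ^ d ≤ G ^ 2 := by
    have := pow_le_pow_left₀ (by positivity) (sqrt_pow_le_Gamma hd) 2
    rwa [← pow_mul, mul_comm d 2, pow_mul, Real.sq_sqrt (by positivity)] at this
  have hM : constM d ^ (d + 1) = 12 ^ (d + 1) * (Real.pi * G ^ 2 / 9) := by
    rw [constM, mul_pow, ← Real.rpow_natCast (_ ^ _), ← Real.rpow_mul (by positivity)]
    congr 1
    push_cast
    rw [one_div_mul_cancel (by positivity), Real.rpow_one]
  have hM2 : (constM d ^ 2) ^ (d + 1) = 144 ^ (d + 1) * (Real.pi * G ^ 2 / 9) ^ 2 := by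
    rw [← pow_mul, mul_comm 2, pow_mul, hM, mul_pow, ← pow_mul, mul_comm (d + 1) 2, pow_mul]
    norm_num
  rw [← pow_le_pow_iff_left₀ (by positivity) (by positivity) (Nat.succ_ne_zero d), hM2]
  have h1 : (d / (2 * e)) ^ d / 3 ≤ Real.pi * G ^ 2 / 9 := by nlinarith [sq_nonneg G]
  have h2 : 144 ^ (d + 1) * ((d / (2 * e)) ^ d / 3) ^ 2
      ≤ 144 ^ (d + 1) * (Real.pi * G ^ 2 / 9) ^ 2 := by gcongr
  refine le_trans ?_ h2
  -- The slack factor `3/2`, raised to the power `d+1`, pays for the extra `9 (d/(2e))²`, which `h5`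
  -- bounds.
  have h3 : 3 / 2 * (4 * d * ((d : ℝ) + 1) / e) ≤ 144 * (d / (2 * e)) ^ 2 := by
    rw [div_pow, mul_pow, mul_div_assoc', mul_div_assoc', div_le_div_iff₀ (by positivity)
      (by positivity)]
    have : e * (d + 1) ≤ 6 * d := by nlinarith
    have h4 : 0 ≤ 24 * d * e := by positivity
    nlinarith [mul_le_mul_of_nonneg_left this h4]
  have h5 : (d / (2 * e)) ^ 2 ≤ (3 / 2 : ℝ) ^ (d + 1) / 9 := by
    have := sq_le_three_mul_pow (d := d)
    rw [div_pow, div_le_iff₀ (by positivity)]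
    have h27 : 27 ≤ (2 * e) ^ 2 := by nlinarith
    nlinarith [show (0 : ℝ) < (3 / 2 : ℝ) ^ (d + 1) by positivity]
  have h6 := pow_le_pow_left₀ (by positivity) h3 (d + 1)
  rw [mul_pow, mul_pow] at h6
  have hu : 0 < (d / (2 * e)) ^ 2 := by positivity
  refine le_of_mul_le_mul_right ?_ hu
  calc (4 * d * ((d : ℝ) + 1) / e) ^ (d + 1) * (d / (2 * e)) ^ 2
      ≤ (4 * d * ((d : ℝ) + 1) / e) ^ (d + 1) * ((3 / 2 : ℝ) ^ (d + 1) / 9) := by gcongr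
    _ ≤ 144 ^ (d + 1) * ((d / (2 * e)) ^ 2) ^ (d + 1) / 9 := by linarith
    _ = _ := by generalize (d : ℝ) / (2 * e) = u; ring

end MultiscaleKernel

/-! ### Lower bound for the quadratic form -/

namespace MultiscaleKernel

open MeasureTheory

theorem sqrt_two_mul_exp_lt : √2 * Real.exp (-4 / Real.exp 1) < 0.35 := by
  have he := Real.exp_one_lt_d9
  have he2 := Real.exp_one_gt_d9
  have h1 : Real.exp (-4 / Real.exp 1) ≤ Real.exp (-(1.47 : ℝ)) := by
    refine Real.exp_le_exp.2 ?_
    rw [div_le_iff₀ (by positivity)]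
    linarith
  have h2 : Real.exp (-(1.47 : ℝ)) ≤ 0.245 := by
    rw [Real.exp_neg, inv_le_comm₀ (by positivity) (by norm_num),
      show (1.47 : ℝ) = 1 + 0.47 by norm_num, Real.exp_add]
    have h3 := Real.quadratic_le_exp_of_nonneg (show (0 : ℝ) ≤ 0.47 by norm_num)
    have h4 : 2.7182818283 * (1 + 0.47 + 0.47 ^ 2 / 2) ≤ Real.exp 1 * Real.exp 0.47 :=
      mul_le_mul he2.le h3 (by norm_num) (by positivity)
    refine le_trans ?_ h4
    norm_num
  have h5 : √2 < 1.4143 := by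
    rw [Real.sqrt_lt' (by norm_num)]; norm_num
  calc √2 * Real.exp (-4 / Real.exp 1) ≤ 1.4143 * 0.245 := by gcongr; exact h1.trans h2
    _ < 0.35 := by norm_num

theorem re_fourier_sub {d : ℕ} {f g : E d → ℝ} (hf : Integrable f) (hg : Integrable g) (w : E d) :
    (𝓕 (fun x : E d => ((f x - g x : ℝ) : ℂ)) w).re
      = (𝓕 (fun x : E d => (f x : ℂ)) w).re - (𝓕 (fun x : E d => (g x : ℂ)) w).re := by
  have hint : ∀ {f : E d → ℝ}, Integrable f →
      Integrable fun v => f v * Real.cos (2 * Real.pi * inner ℝ v w) :=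
    fun hf => hf.mul_bdd (c := 1) (Continuous.aestronglyMeasurable (by fun_prop))
      (Filter.Eventually.of_forall fun v => by simpa using Real.abs_cos_le_one _)
  rw [re_fourier_eq_integral (f := fun x => f x - g x) (hf.sub hg), re_fourier_eq_integral hf, re_fourier_eq_integral hg,
    ← integral_sub (hint hf) (hint hg)]
  simp only [sub_mul]

theorem re_fourier_const_mul {d : ℕ} {f : E d → ℝ} (hf : Integrable f) (m : ℝ) (w : E d) :
    (𝓕 (fun x : E d => ((m * f x : ℝ) : ℂ)) w).re = m * (𝓕 (fun x : E d => (f x : ℂ)) w).re := by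
  rw [re_fourier_eq_integral (hf.const_mul m), re_fourier_eq_integral hf, ← integral_const_mul]
  simp only [mul_assoc]

/-- A difference of two gaussians that minorizes the indicator of a ball. -/
theorem gaussian_sub_gaussian_le {d : ℕ} {a ρ : ℝ} (ha : 0 < a) (hρ : 0 < ρ) (ξ : E d) :
    Real.exp (-a * ‖ξ‖ ^ 2) - Real.exp (-(a / 2) * ρ ^ 2) * Real.exp (-(a / 2) * ‖ξ‖ ^ 2)
      ≤ if ‖ξ‖ ≤ ρ then 1 else 0 := by
  split_ifs with h
  · have h1 : Real.exp (-a * ‖ξ‖ ^ 2) ≤ 1 :=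
      Real.exp_le_one_iff.2 (by nlinarith [sq_nonneg ‖ξ‖])
    have h2 : 0 ≤ Real.exp (-(a / 2) * ρ ^ 2) * Real.exp (-(a / 2) * ‖ξ‖ ^ 2) := by positivity
    linarith
  · rw [sub_nonpos, ← Real.exp_add]
    refine Real.exp_le_exp.2 ?_
    have h3 : ρ ^ 2 ≤ ‖ξ‖ ^ 2 := by
      have := (not_le.1 h).le
      gcongr
    nlinarith

variable {d : ℕ} {τ cΦ CΦ : ℝ} {Φ : E d → ℝ}

namespace IsAdmissibleKernel

/-- The number `m` bounds the transform of `Φ` from below on the ball of radius `ρ`. Subtracting `m`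
times the Gaussian difference therefore leaves a nonnegative function, to which
`sum_re_fourier_nonneg` applies. -/
theorem sum_gaussian_le_sum (h : IsAdmissibleKernel d τ cΦ CΦ Φ) {ι : Type*} [Fintype ι]
    (z : ι → E d) (c : ι → ℝ) {a ρ m : ℝ} (ha : 0 < a) (hρ : 0 < ρ) (hm0 : 0 ≤ m)
    (hm : m ≤ (2 * Real.pi) ^ ((d : ℝ) / 2) * cΦ * (1 + (2 * Real.pi * ρ) ^ 2) ^ (-τ)) :
    m * (Real.pi / a) ^ ((d : ℝ) / 2)
        * ((∑ i, ∑ j, c i * c j * Real.exp (-Real.pi ^ 2 * ‖z i - z j‖ ^ 2 / a))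
          - 2 ^ ((d : ℝ) / 2) * Real.exp (-(a / 2) * ρ ^ 2)
            * ∑ i, ∑ j, c i * c j * Real.exp (-Real.pi ^ 2 * ‖z i - z j‖ ^ 2 / (a / 2)))
      ≤ ∑ i, ∑ j, c i * c j * Φ (z i - z j) := by
  set F : E d → ℝ := fun ξ => (𝓕 (fun x : E d => (Φ x : ℂ)) ξ).re with hF
  set ε := Real.exp (-(a / 2) * ρ ^ 2) with hε
  have ha2 : 0 < a / 2 := by positivity
  have hg1 := integrable_gaussian (d := d) ha
  have hg2 := (integrable_gaussian (d := d) ha2)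
  have hg : Integrable fun x : E d =>
      Real.exp (-a * ‖x‖ ^ 2) - ε * Real.exp (-(a / 2) * ‖x‖ ^ 2) := hg1.sub (hg2.const_mul ε)
  have hpos := sum_re_fourier_nonneg (f := fun x : E d =>
      F x - m * (Real.exp (-a * ‖x‖ ^ 2) - ε * Real.exp (-(a / 2) * ‖x‖ ^ 2)))
      (h.integrable_re_fourier.sub (hg.const_mul m)) (fun ξ => by
    have h1 := gaussian_sub_gaussian_le ha hρ ξ
    rw [sub_nonneg]
    refine (mul_le_mul_of_nonneg_left h1 hm0).trans ?_
    split_ifs with hξ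
    · rw [mul_one]
      refine (hm.trans ?_).trans (h.le_re_fourier ξ)
      have := h.lower_pos
      gcongr ?_ * ?_
      refine Real.rpow_le_rpow_of_nonpos (by positivity) (by gcongr) ?_
      linarith [h.exponent_pos]
    · rw [mul_zero]
      exact h.re_fourier_nonneg ξ) z c
  have key : ∀ w : E d, (𝓕 (fun x : E d => ((F x - m * (Real.exp (-a * ‖x‖ ^ 2)
      - ε * Real.exp (-(a / 2) * ‖x‖ ^ 2)) : ℝ) : ℂ)) w).re
      = Φ w - m * (Real.pi / a) ^ ((d : ℝ) / 2) * (Real.exp (-Real.pi ^ 2 * ‖w‖ ^ 2 / a)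
        - 2 ^ ((d : ℝ) / 2) * ε * Real.exp (-Real.pi ^ 2 * ‖w‖ ^ 2 / (a / 2))) := by
    intro w
    have e1 := re_fourier_sub h.integrable_re_fourier (hg.const_mul m) w
    have e2 := re_fourier_const_mul hg m w
    have e3 := re_fourier_sub hg1 (hg2.const_mul ε) w
    have e4 := re_fourier_const_mul hg2 ε w
    rw [re_fourier_gaussian ha2] at e4
    rw [e4, re_fourier_gaussian ha] at e3
    have e5 : (Real.pi / (a / 2)) ^ ((d : ℝ) / 2)
        = 2 ^ ((d : ℝ) / 2) * (Real.pi / a) ^ ((d : ℝ) / 2) := by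
      rw [← Real.mul_rpow (by norm_num) (by positivity)]
      congr 1
      field_simp
    rw [e1, e2, e3, h.eq_re_fourier_fourier, e5]
    ring
  simp only [key] at hpos
  rw [← sub_nonneg]
  convert hpos using 1
  simp only [mul_sub, Finset.sum_sub_distrib, Finset.mul_sum]
  congr 2
  all_goals
    refine Finset.sum_congr rfl fun i _ => Finset.sum_congr rfl fun j _ => ?_
    ring

/-- The only loss is `Γ(d/2+1) ≥ (d/(2e))^(d/2)`; all else is an identity. -/
theorem constC_le (hd : 1 ≤ d) {s : ℝ} (hs : 0 < s) :
    constC d * (s ^ d)⁻¹ ≤ (2 * Real.pi) ^ ((d : ℝ) / 2)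
      * (Real.pi / (8 * Real.pi ^ 2 * d * s ^ 2 / (Real.exp 1 * constM d ^ 2))) ^ ((d : ℝ) / 2)
      * (1 / 2) := by
  have hd0 : (0 : ℝ) < d := by exact_mod_cast hd
  have hM := constM_pos d
  have hΓ := Real.Gamma_pos_of_pos (show 0 < (d : ℝ) / 2 + 1 by positivity)
  have hG := sqrt_pow_le_Gamma hd
  have e1 : 2 * Real.pi * (Real.pi / (8 * Real.pi ^ 2 * d * s ^ 2 / (Real.exp 1 * constM d ^ 2)))
      = (constM d / (2 * s)) ^ 2 * (Real.exp 1 / d) := by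
    field_simp
    norm_num
  have e2 : (2 : ℝ) ^ ((3 : ℝ) / 2) = 2 * √2 := by
    rw [show (3 : ℝ) / 2 = 1 + 1 / 2 by norm_num, Real.rpow_add (by norm_num), Real.rpow_one,
      Real.sqrt_eq_rpow]
  rw [← Real.mul_rpow (by positivity) (by positivity), e1, rpow_half_natCast (by positivity),
    Real.sqrt_mul (by positivity), Real.sqrt_sq (by positivity), constC, e2]
  have e3 : √(Real.exp 1 / d) * √((d : ℝ) / (2 * Real.exp 1)) = 1 / √2 := by
    rw [← Real.sqrt_mul (by positivity), ← Real.sqrt_one, ← Real.sqrt_div (by norm_num),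
      Real.sqrt_one]
    congr 1
    field_simp
  have e4 : (constM d / (2 * √2)) ^ d * (s ^ d)⁻¹
      = (constM d / (2 * s) * √(Real.exp 1 / d)) ^ d * √((d : ℝ) / (2 * Real.exp 1)) ^ d := by
    rw [← inv_pow, ← mul_pow, ← mul_pow, mul_assoc (constM d / (2 * s)), e3]
    congr 1
    field_simp
  rw [mul_assoc, e4, mul_comm, mul_assoc]
  gcongr
  rw [mul_one_div, div_le_div_iff₀ (by positivity) (by norm_num)]
  linarith

/-- Lower bound for the least eigenvalue of the interpolation matrix in terms of the separation. -/
theorem constC_mul_le_sum (hd : 1 ≤ d) (h : IsAdmissibleKernel d τ cΦ CΦ Φ) {ι : Type*} [Fintype ι]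
    {z : ι → E d} {s : ℝ} (hs : 0 < s) (hz : ∀ i j, i ≠ j → 2 * s ≤ ‖z i - z j‖) (c : ι → ℝ) :
    constC d * cΦ * (1 + (2 * constM d / s) ^ 2) ^ (-τ) * (s ^ d)⁻¹ * ∑ i, c i ^ 2
      ≤ ∑ i, ∑ j, c i * c j * Φ (z i - z j) := by
  classical
  have hd0 : (0 : ℝ) < d := by exact_mod_cast hd
  have hM := constM_pos d
  have hc := h.lower_pos
  set M := constM d with hMdef
  set e := Real.exp 1 with he
  have he0 : 0 < e := Real.exp_pos 1
  -- With `ρ = M/(πs)`, so that `2πρ = 2M/s`, this `a` gives `aρ²/2 = 4d/e` and `π²s²/a = eM²/(8d)`,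
  -- the `X` below.
  set a := 8 * Real.pi ^ 2 * d * s ^ 2 / (e * M ^ 2) with hadef
  have ha : 0 < a := by positivity
  set m := (2 * Real.pi) ^ ((d : ℝ) / 2) * cΦ * (1 + (2 * M / s) ^ 2) ^ (-τ) with hm
  have hm0 : 0 ≤ m := by positivity
  have hmain := h.sum_gaussian_le_sum z c ha (ρ := M / (Real.pi * s)) (by positivity) hm0 (by
    rw [hm]
    apply le_of_eq
    congr 3
    field_simp)
  set X := e * M ^ 2 / (8 * d) with hX
  have hX1 : ((d : ℝ) + 1) / 2 ≤ X := by
    have := le_constM_sq hd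
    rw [div_le_iff₀ he0] at this
    rw [hX, div_le_div_iff₀ (by norm_num) (by positivity)]
    linarith
  have hX0 : 0 < X := lt_of_lt_of_le (by positivity) hX1
  have e1 : ∀ w : E d, -Real.pi ^ 2 * ‖w‖ ^ 2 / a = -X * (‖w‖ / s) ^ 2 := by
    intro w
    rw [hadef, hX]
    field_simp
  have e2 : ∀ w : E d, -Real.pi ^ 2 * ‖w‖ ^ 2 / (a / 2) = -(2 * X) * (‖w‖ / s) ^ 2 := by
    intro w
    rw [hadef, hX]
    field_simp
  have hη : 2 ^ ((d : ℝ) / 2) * Real.exp (-(a / 2) * (M / (Real.pi * s)) ^ 2) ≤ 0.35 := by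
    have h1 : -(a / 2) * (M / (Real.pi * s)) ^ 2 = d * (-4 / e) := by
      rw [hadef]
      field_simp
      norm_num
    rw [h1, Real.exp_nat_mul, rpow_half_natCast (by norm_num), ← mul_pow]
    have h2 := sqrt_two_mul_exp_lt
    exact (pow_le_of_le_one (by positivity) (by linarith) (by omega)).trans h2.le
  simp only [e1, e2] at hmain
  have hbound : ∀ {Y : ℝ}, ((d : ℝ) + 1) / 2 ≤ Y →
      |(∑ i, ∑ j, c i * c j * Real.exp (-Y * (‖z i - z j‖ / s) ^ 2)) - ∑ i, c i ^ 2|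
        ≤ 1 / 9 * ∑ i, c i ^ 2 := fun {Y} hY =>
    abs_sum_sub_le_of_diag_eq_one (fun i j => by rw [norm_sub_rev]) (fun i => by simp)
      (fun i => by
        simp only [Real.abs_exp]
        exact sum_gaussian_le hd hs hz hY i) c
  have hb1 := (abs_le.1 (hbound hX1)).1
  have hb2 := (abs_le.1 (hbound (show ((d : ℝ) + 1) / 2 ≤ 2 * X by linarith))).2
  refine le_trans ?_ hmain
  set S := ∑ i, c i ^ 2 with hS
  have hS0 : 0 ≤ S := Finset.sum_nonneg fun i _ => sq_nonneg _
  set T := ∑ i, ∑ j, c i * c j * Real.exp (-(2 * X) * (‖z i - z j‖ / s) ^ 2)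
  set η := 2 ^ ((d : ℝ) / 2) * Real.exp (-(a / 2) * (M / (Real.pi * s)) ^ 2)
  have hη0 : 0 ≤ η := by positivity
  have hηT : η * T ≤ 0.35 * (10 / 9 * S) := by
    calc η * T ≤ η * (10 / 9 * S) := by gcongr; linarith
      _ ≤ _ := by gcongr
  -- The numbers fit exactly: `8/9 - 0.35 · 10/9 = 1/2`.
  have hbr : 1 / 2 * S ≤ (∑ i, ∑ j, c i * c j * Real.exp (-X * (‖z i - z j‖ / s) ^ 2)) - η * T := by
    linarith
  refine le_trans ?_ (mul_le_mul_of_nonneg_left hbr (by positivity))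
  have hC := constC_le hd hs
  rw [← mul_assoc]
  gcongr ?_ * S
  calc constC d * cΦ * (1 + (2 * M / s) ^ 2) ^ (-τ) * (s ^ d)⁻¹
      = (constC d * (s ^ d)⁻¹) * (cΦ * (1 + (2 * M / s) ^ 2) ^ (-τ)) := by ring
    _ ≤ ((2 * Real.pi) ^ ((d : ℝ) / 2) * (Real.pi / a) ^ ((d : ℝ) / 2) * (1 / 2))
        * (cΦ * (1 + (2 * M / s) ^ 2) ^ (-τ)) := by gcongr
    _ = _ := by rw [hm]; ring

end IsAdmissibleKernel

end MultiscaleKernel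

/-! ### Decay of inverses of band matrices; geometry of the point sets -/

namespace MultiscaleKernel

open MeasureTheory

section MatrixDecay

open Matrix

variable {ι V : Type*} [Fintype ι] [SeminormedAddCommGroup V]

/-- No spectral theorem is needed: nonnegativity of the form at `r v - B v` and its upper bound at
`B v` give `‖Bv‖² ≤ r ⟨v, Bv⟩`. -/
theorem dotProduct_mulVec_self_le {B : Matrix ι ι ℝ} (hB : B.IsSymm) {r : ℝ} (hr : 0 < r)
    (h0 : ∀ v, 0 ≤ v ⬝ᵥ B *ᵥ v) (h1 : ∀ v, v ⬝ᵥ B *ᵥ v ≤ r * (v ⬝ᵥ v)) (v : ι → ℝ) :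
    (B *ᵥ v) ⬝ᵥ (B *ᵥ v) ≤ r ^ 2 * (v ⬝ᵥ v) := by
  have e1 : v ⬝ᵥ B *ᵥ (B *ᵥ v) = (B *ᵥ v) ⬝ᵥ (B *ᵥ v) := by
    rw [dotProduct_mulVec v B, ← mulVec_transpose, hB.eq]
  have h2 := h1 (B *ᵥ v)
  have h3 := h0 (r • v - B *ᵥ v)
  simp only [mulVec_sub, mulVec_smul, sub_dotProduct, dotProduct_sub, smul_dotProduct,
    dotProduct_smul, smul_eq_mul, e1] at h3
  have h4 := h1 v
  have h5 : r * ((B *ᵥ v) ⬝ᵥ (B *ᵥ v)) ≤ r * (r * (v ⬝ᵥ B *ᵥ v)) := by linarith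
  have h6 := le_of_mul_le_mul_left h5 hr
  nlinarith

theorem zero_le_dotProduct_self (v : ι → ℝ) : 0 ≤ v ⬝ᵥ v :=
  Finset.sum_nonneg fun i _ => mul_self_nonneg (v i)

variable [DecidableEq ι]

theorem dotProduct_pow_mulVec_self_le {B : Matrix ι ι ℝ} (hB : B.IsSymm) {r : ℝ} (hr : 0 < r)
    (h0 : ∀ v, 0 ≤ v ⬝ᵥ B *ᵥ v) (h1 : ∀ v, v ⬝ᵥ B *ᵥ v ≤ r * (v ⬝ᵥ v)) (n : ℕ) (v : ι → ℝ) :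
    (B ^ n *ᵥ v) ⬝ᵥ (B ^ n *ᵥ v) ≤ (r ^ n) ^ 2 * (v ⬝ᵥ v) := by
  induction n with
  | zero => simp
  | succ k ih =>
    rw [pow_succ' B, ← mulVec_mulVec]
    refine (dotProduct_mulVec_self_le hB hr h0 h1 _).trans ?_
    rw [pow_succ' r k, mul_pow, mul_assoc]
    gcongr

theorem isUnit_det_of_coercive {A : Matrix ι ι ℝ} {lam : ℝ} (hlam : 0 < lam)
    (hlo : ∀ v, lam * (v ⬝ᵥ v) ≤ v ⬝ᵥ A *ᵥ v) : IsUnit A.det := by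
  rw [isUnit_iff_ne_zero]
  intro hdet
  obtain ⟨v, hv, hAv⟩ := exists_mulVec_eq_zero_iff.2 hdet
  have h := hlo v
  rw [hAv, dotProduct_zero] at h
  have h2 : v ⬝ᵥ v = 0 := le_antisymm (by nlinarith) (zero_le_dotProduct_self v)
  exact hv (dotProduct_self_eq_zero.1 h2)

/-- Cauchy–Schwarz in `lam ‖w‖² ≤ ⟨w, v⟩` for `w = A⁻¹ v`. -/
theorem inv_mulVec_dotProduct_self_le {A : Matrix ι ι ℝ} {lam : ℝ} (hlam : 0 < lam)
    (hlo : ∀ v, lam * (v ⬝ᵥ v) ≤ v ⬝ᵥ A *ᵥ v) (v : ι → ℝ) :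
    lam ^ 2 * ((A⁻¹ *ᵥ v) ⬝ᵥ (A⁻¹ *ᵥ v)) ≤ v ⬝ᵥ v := by
  set w := A⁻¹ *ᵥ v with hw
  have hAw : A *ᵥ w = v := by
    rw [hw, mulVec_mulVec, mul_nonsing_inv _ (isUnit_det_of_coercive hlam hlo), one_mulVec]
  have h1 := hlo w
  rw [hAw] at h1
  have h2 : (w ⬝ᵥ v) ^ 2 ≤ (w ⬝ᵥ w) * (v ⬝ᵥ v) := by
    simpa only [dotProduct, sq] using Finset.sum_mul_sq_le_sq_mul_sq Finset.univ w v
  have hw0 := zero_le_dotProduct_self w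
  have hv0 := zero_le_dotProduct_self v
  rcases hw0.eq_or_lt with h | h
  · rw [← h]; simpa using hv0
  · have h3 : (lam * (w ⬝ᵥ w)) ^ 2 ≤ (w ⬝ᵥ v) ^ 2 := by gcongr
    refine le_of_mul_le_mul_left ?_ h
    nlinarith

theorem pow_apply_eq_zero_of_band {B : Matrix ι ι ℝ} {x : ι → V} {δ : ℝ}
    (hband : ∀ i j, i ≠ j → δ < ‖x i - x j‖ → B i j = 0) (hδ : 0 < δ) (n : ℕ) (i j : ι)
    (hij : n * δ < ‖x i - x j‖) : (B ^ n) i j = 0 := by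
  induction n generalizing i with
  | zero =>
    rw [pow_zero, one_apply_ne]
    rintro rfl
    simp at hij
  | succ k ih =>
    rw [pow_succ', mul_apply]
    refine Finset.sum_eq_zero fun l _ => ?_
    push_cast at hij
    have htri : ‖x i - x j‖ ≤ ‖x i - x l‖ + ‖x l - x j‖ := norm_sub_le_norm_sub_add_norm_sub _ _ _
    by_cases hl : k * δ < ‖x l - x j‖
    · rw [ih l hl, mul_zero]
    · have h : δ < ‖x i - x l‖ := by linarith
      rw [hband i l (by rintro rfl; simp at h; linarith) h, zero_mul]

/-- Exponential off-diagonal decay of the inverse of a band matrix with spectrum in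
`[lam, Lam]`. -/
theorem abs_inv_apply_le_of_band {A : Matrix ι ι ℝ} (hA : A.IsSymm) {lam Lam : ℝ} (hlam : 0 < lam)
    (hlt : lam < Lam) (hlo : ∀ v, lam * (v ⬝ᵥ v) ≤ v ⬝ᵥ A *ᵥ v)
    (hhi : ∀ v, v ⬝ᵥ A *ᵥ v ≤ Lam * (v ⬝ᵥ v)) {x : ι → V} {δ : ℝ} (hδ : 0 < δ)
    (hband : ∀ i j, δ < ‖x i - x j‖ → A i j = 0) (i j : ι) :
    |A⁻¹ i j| ≤ lam⁻¹ * (1 - lam / Lam) ^ (‖x i - x j‖ / δ) := by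
  have hLam : 0 < Lam := hlam.trans hlt
  set r := 1 - lam / Lam with hr
  have hr0 : 0 < r := by rw [hr, sub_pos, div_lt_one hLam]; exact hlt
  have hr1 : r ≤ 1 := by rw [hr]; have : 0 < lam / Lam := by positivity
                         linarith
  set B : Matrix ι ι ℝ := 1 - Lam⁻¹ • A with hB
  have hform : ∀ v, v ⬝ᵥ B *ᵥ v = v ⬝ᵥ v - Lam⁻¹ * (v ⬝ᵥ A *ᵥ v) := by
    intro v
    rw [hB, sub_mulVec, one_mulVec, dotProduct_sub, smul_mulVec, dotProduct_smul, smul_eq_mul]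
  have h0 : ∀ v, 0 ≤ v ⬝ᵥ B *ᵥ v := by
    intro v
    rw [hform, sub_nonneg, inv_mul_le_iff₀ hLam]
    exact hhi v
  have h1 : ∀ v, v ⬝ᵥ B *ᵥ v ≤ r * (v ⬝ᵥ v) := by
    intro v
    rw [hform, hr, sub_mul, one_mul, div_eq_inv_mul, mul_assoc]
    gcongr
    exact hlo v
  have hBs : B.IsSymm := (isSymm_one).sub (hA.smul _)
  have hBband : ∀ i j, i ≠ j → δ < ‖x i - x j‖ → B i j = 0 := by
    intro i j hne h
    simp [hB, one_apply_ne hne, hband i j h]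
  have hdet := isUnit_det_of_coercive hlam hlo
  -- Every `k < n` satisfies `k δ < ‖x i - x j‖`, so none of the powers in the partial Neumann sum
  -- reaches the entry `(i, j)`.
  set n := ⌈‖x i - x j‖ / δ⌉₊ with hn
  have hexp : A⁻¹ = Lam⁻¹ • ∑ k ∈ Finset.range n, B ^ k + A⁻¹ * B ^ n := by
    have h2 : (Lam⁻¹ • A) * ∑ k ∈ Finset.range n, B ^ k = 1 - B ^ n := by
      have := mul_neg_geom_sum B n
      rwa [hB, sub_sub_cancel] at this
    have h3 : A⁻¹ * ((Lam⁻¹ • A) * ∑ k ∈ Finset.range n, B ^ k)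
        = Lam⁻¹ • ∑ k ∈ Finset.range n, B ^ k := by
      rw [← mul_assoc, mul_smul_comm, nonsing_inv_mul _ hdet, smul_mul_assoc, one_mul]
    rw [← h3, h2, mul_sub, mul_one, sub_add_cancel]
  have hsum : (∑ k ∈ Finset.range n, B ^ k) i j = 0 := by
    rw [Matrix.sum_apply]
    refine Finset.sum_eq_zero fun k hk => pow_apply_eq_zero_of_band hBband hδ k i j ?_
    rw [← lt_div_iff₀ hδ]
    exact Nat.lt_ceil.1 (Finset.mem_range.1 hk)
  have hentry : A⁻¹ i j = (A⁻¹ *ᵥ (B ^ n *ᵥ Pi.single j 1)) i := by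
    rw [mulVec_mulVec, mulVec_single_one, col_apply]
    conv_lhs => rw [hexp]
    simp [hsum]
  set u := B ^ n *ᵥ Pi.single j (1 : ℝ) with hu
  have h4 := inv_mulVec_dotProduct_self_le hlam hlo u
  have h5 : u ⬝ᵥ u ≤ (r ^ n) ^ 2 := by
    have := dotProduct_pow_mulVec_self_le hBs hr0 h0 h1 n (Pi.single j 1)
    rwa [dotProduct_single_one, Pi.single_eq_same, mul_one] at this
  have h6 : (A⁻¹ i j) ^ 2 ≤ (A⁻¹ *ᵥ u) ⬝ᵥ (A⁻¹ *ᵥ u) := by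
    rw [hentry, sq]
    exact Finset.single_le_sum (f := fun k => (A⁻¹ *ᵥ u) k * (A⁻¹ *ᵥ u) k)
      (fun k _ => mul_self_nonneg _) (Finset.mem_univ i)
  have h7 : lam * |A⁻¹ i j| ≤ r ^ n := by
    refine le_of_sq_le_sq ?_ (by positivity)
    rw [mul_pow, sq_abs]
    nlinarith [sq_nonneg lam]
  have h8 : r ^ n ≤ r ^ (‖x i - x j‖ / δ) := by
    rw [← Real.rpow_natCast]
    exact Real.rpow_le_rpow_of_exponent_ge hr0 hr1 (Nat.le_ceil _)
  rw [le_inv_mul_iff₀ hlam]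
  exact h7.trans h8

end MatrixDecay

section Points

variable {d n : ℕ} {Ω : Set (E d)} {x : Fin n → E d}

theorem separationDistance_nonneg (X : Set (E d)) : 0 ≤ separationDistance X :=
  div_nonneg Set.infsep_nonneg zero_le_two

theorem two_mul_separationDistance_le (hx : Function.Injective x) {i j : Fin n} (hij : i ≠ j) :
    2 * separationDistance (Set.range x) ≤ ‖x i - x j‖ := by
  rw [separationDistance, mul_div_cancel₀ _ two_ne_zero, ← dist_eq_norm]
  exact Set.infsep_le_dist_of_mem (Set.mem_range_self i) (Set.mem_range_self j)
    (hx.ne hij)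

/-- An interior point makes `Ω` infinite, so some point of `Ω` misses the finite set; boundedness
keeps the real supremum from taking its default value. -/
theorem fillDistance_pos (hd : 1 ≤ d) (hb : Bornology.IsBounded Ω) (hΩ : (interior Ω).Nonempty)
    (i : Fin n) : 0 < fillDistance Ω (Set.range x) := by
  have : Nonempty (Fin d) := ⟨⟨0, hd⟩⟩
  obtain ⟨p, hp⟩ := hΩ
  have hinf : Ω.Infinite := infinite_of_mem_nhds p (mem_interior_iff_mem_nhds.1 hp)
  obtain ⟨y, hy, hyX⟩ := hinf.exists_notMem_finite (Set.finite_range x)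
  have hne : (Set.range x).Nonempty := ⟨_, Set.mem_range_self i⟩
  have hpos : 0 < Metric.infDist y (Set.range x) :=
    ((Set.finite_range x).isClosed.notMem_iff_infDist_pos hne).1 hyX
  refine hpos.trans_le (le_ciSup (f := fun y : Ω => Metric.infDist (y : E d) (Set.range x)) ?_
    ⟨y, hy⟩)
  obtain ⟨C, hC⟩ := hb.subset_closedBall (x i)
  refine ⟨C, ?_⟩
  rintro _ ⟨⟨w, hw⟩, rfl⟩
  exact (Metric.infDist_le_dist_of_mem (Set.mem_range_self i)).trans (hC hw)

/-- Since `Set.infsep` is `0` on a single point, the hypothesis on the fill distance rules out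
one-point sets. -/
theorem separationDistance_pos (hd : 1 ≤ d) (hb : Bornology.IsBounded Ω)
    (hΩ : (interior Ω).Nonempty) (i : Fin n) {cq : ℝ}
    (h : fillDistance Ω (Set.range x) ≤ cq * separationDistance (Set.range x)) :
    0 < separationDistance (Set.range x) := by
  refine (separationDistance_nonneg _).lt_of_ne fun h0 => ?_
  rw [← h0, mul_zero] at h
  exact absurd (fillDistance_pos hd hb hΩ i) (not_lt.2 h)

end Points

end MultiscaleKernel

/-! ### Estimates for the kernel matrix and the Lagrange functions -/

namespace MultiscaleKernel

open MeasureTheory Matrix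

theorem constK_pos {d : ℕ} {τ cΦ ν cq : ℝ} (hc : 0 < cΦ) : 0 < constK d τ cΦ ν cq := by
  have := constC_pos d
  rw [constK]
  positivity

theorem inv_constK {d : ℕ} {τ cΦ ν cq : ℝ} :
    (constK d τ cΦ ν cq)⁻¹
      = constC d * cΦ * (1 + 4 * constM d ^ 2 * ν ^ 2 * cq ^ 2) ^ (-τ) := by
  rw [constK, mul_inv, inv_inv, Real.rpow_neg (by positivity)]

variable {d : ℕ} {τ cΦ CΦ ν cq : ℝ} {Φ : E d → ℝ}

namespace IsAdmissibleKernel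

/-- Positive semidefiniteness on the two points `w, 0` with coefficients `(1, ±1)`. -/
theorem abs_le_apply_zero (h : IsAdmissibleKernel d τ cΦ CΦ Φ) (w : E d) : |Φ w| ≤ Φ 0 := by
  have key : ∀ t : ℝ, 0 ≤ Φ 0 + t * Φ w + (t * Φ w + t * t * Φ 0) := by
    intro t
    have := sum_re_fourier_nonneg h.integrable_re_fourier h.re_fourier_nonneg
      (![w, 0] : Fin 2 → E d) ![1, t]
    simpa [Fin.sum_univ_two, h.eq_re_fourier_fourier, h.map_neg] using this
  have h1 := key 1
  have h2 := key (-1)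
  rw [abs_le]
  constructor <;> linarith

theorem inv_constK_mul_le_sum (hd : 1 ≤ d) (h : IsAdmissibleKernel d τ cΦ CΦ Φ) {ι : Type*}
    [Fintype ι] {z : ι → E d} {t : ℝ} (ht : 0 < t) (htν : t ≤ ν * cq)
    (hz : ∀ i j, i ≠ j → 2 * t⁻¹ ≤ ‖z i - z j‖) (c : ι → ℝ) :
    (constK d τ cΦ ν cq)⁻¹ * t ^ d * ∑ i, c i ^ 2 ≤ ∑ i, ∑ j, c i * c j * Φ (z i - z j) := by
  have hM := constM_pos d
  have hC := constC_pos d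
  have hc := h.lower_pos
  refine le_trans ?_ (h.constC_mul_le_sum hd (inv_pos.2 ht) hz c)
  rw [inv_constK, inv_pow, inv_inv, div_inv_eq_mul]
  gcongr ?_ * ?_ * ?_
  gcongr ?_ * ?_
  refine Real.rpow_le_rpow_of_nonpos (by positivity) ?_ (by linarith [h.exponent_pos])
  have : (2 * constM d * t) ^ 2 ≤ (2 * constM d * (ν * cq)) ^ 2 := by gcongr
  linarith

/-- The lower bound for the quadratic form on a single point. -/
theorem pow_le_apply_zero_mul_constK (hd : 1 ≤ d) (h : IsAdmissibleKernel d τ cΦ CΦ Φ) {t : ℝ}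
    (ht : 0 < t) (htν : t ≤ ν * cq) : t ^ d ≤ Φ 0 * constK d τ cΦ ν cq := by
  have hK := constK_pos (d := d) (τ := τ) (ν := ν) (cq := cq) h.lower_pos
  have := h.inv_constK_mul_le_sum hd (ι := Unit) (z := fun _ => 0) ht htν
    (fun i j hij => absurd (Subsingleton.elim i j) hij) fun _ => 1
  simp only [Finset.univ_unique, Finset.sum_const, Finset.card_singleton, one_smul, one_pow,
    mul_one, sub_self, one_mul] at this
  rwa [inv_mul_le_iff₀ hK, mul_comm] at this

theorem apply_zero_pos (h : IsAdmissibleKernel d τ cΦ CΦ Φ) (hd : 1 ≤ d) : 0 < Φ 0 := by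
  have hK := constK_pos (d := d) (τ := τ) (ν := 1) (cq := 1) h.lower_pos
  have := h.pow_le_apply_zero_mul_constK hd (t := 1) (ν := 1) (cq := 1) one_pos (by norm_num)
  rw [one_pow] at this
  by_contra hneg
  nlinarith

theorem scaledKernel_eq_zero (h : IsAdmissibleKernel d τ cΦ CΦ Φ) {δ : ℝ} (hδ : 0 < δ) {w : E d}
    (hw : δ < ‖w‖) : scaledKernel Φ δ w = 0 := by
  rw [scaledKernel, h.eq_zero_of_one_lt_norm, mul_zero]
  rw [norm_smul, norm_inv, Real.norm_of_nonneg hδ.le, inv_mul_eq_div, one_lt_div hδ]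
  exact hw

theorem abs_scaledKernel_le (h : IsAdmissibleKernel d τ cΦ CΦ Φ) {δ : ℝ} (hδ : 0 < δ) (w : E d) :
    |scaledKernel Φ δ w| ≤ (δ ^ d)⁻¹ * Φ 0 := by
  rw [scaledKernel, abs_mul, abs_of_pos (by positivity)]
  gcongr
  exact h.abs_le_apply_zero _

theorem scaledKernel_neg (h : IsAdmissibleKernel d τ cΦ CΦ Φ) (δ : ℝ) (w : E d) :
    scaledKernel Φ δ (-w) = scaledKernel Φ δ w := by
  rw [scaledKernel, scaledKernel, smul_neg, h.map_neg]

variable {n : ℕ} {x : Fin n → E d} {q δ : ℝ}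

theorem kernelMatrix_isSymm (h : IsAdmissibleKernel d τ cΦ CΦ Φ) (δ : ℝ) (x : Fin n → E d) :
    (kernelMatrix Φ δ x).IsSymm := by
  ext i j
  simp only [kernelMatrix, transpose_apply, of_apply]
  rw [← h.scaledKernel_neg, neg_sub]

theorem sum_abs_scaledKernel_le (hd : 1 ≤ d) (h : IsAdmissibleKernel d τ cΦ CΦ Φ) (hq : 0 < q)
    (hsep : ∀ i j, i ≠ j → 2 * q ≤ ‖x i - x j‖) (hδ : 0 < δ) (hδq : δ ≤ ν * cq * q) (y : E d) :
    ∑ k, |scaledKernel Φ δ (y - x k)| ≤ (1 + ν * cq) ^ d * ((δ ^ d)⁻¹ * Φ 0) := by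
  classical
  have hΦ0 := h.apply_zero_pos hd
  have hcard := card_le_of_separated hq hsep y hδ.le ({k | ‖y - x k‖ ≤ δ} : Finset (Fin n))
    (by simp)
  have hsum : ∑ k, |scaledKernel Φ δ (y - x k)|
      = ∑ k with ‖y - x k‖ ≤ δ, |scaledKernel Φ δ (y - x k)| := by
    symm
    refine Finset.sum_subset (Finset.subset_univ _) fun k _ hk => ?_
    rw [h.scaledKernel_eq_zero hδ (by simpa using hk), abs_zero]
  rw [hsum]
  refine (Finset.sum_le_card_nsmul _ _ _ fun k _ => h.abs_scaledKernel_le hδ _).trans ?_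
  rw [nsmul_eq_mul]
  have : δ / q ≤ ν * cq := by rwa [div_le_iff₀ hq]
  gcongr
  exact hcard.trans (by gcongr)

theorem kernelMatrix_dotProduct (v : Fin n → ℝ) :
    v ⬝ᵥ kernelMatrix Φ δ x *ᵥ v = ∑ i, ∑ j, v i * v j * scaledKernel Φ δ (x i - x j) := by
  simp only [dotProduct, mulVec, kernelMatrix, of_apply, Finset.mul_sum]
  refine Finset.sum_congr rfl fun i _ => Finset.sum_congr rfl fun j _ => by ring

/-- The points `δ⁻¹ x_i` are `2q/δ`-separated, so the unscaled bound holds with `t = δ/q`; the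
factor `δ^(-d)` turns `t^d` into `q^(-d)`. -/
theorem le_kernelMatrix_dotProduct (hd : 1 ≤ d) (h : IsAdmissibleKernel d τ cΦ CΦ Φ) (hq : 0 < q)
    (hsep : ∀ i j, i ≠ j → 2 * q ≤ ‖x i - x j‖) (hδ : 0 < δ) (hδq : δ ≤ ν * cq * q)
    (v : Fin n → ℝ) :
    (constK d τ cΦ ν cq * q ^ d)⁻¹ * (v ⬝ᵥ v) ≤ v ⬝ᵥ kernelMatrix Φ δ x *ᵥ v := by
  have h1 := h.inv_constK_mul_le_sum hd (z := fun i => δ⁻¹ • x i) (t := δ / q) (ν := ν) (cq := cq)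
    (by positivity) (by rwa [div_le_iff₀ hq]) (fun i j hij => by
      rw [← smul_sub, norm_smul, norm_inv, Real.norm_of_nonneg hδ.le, inv_div, inv_mul_eq_div,
        mul_div_assoc']
      gcongr
      exact hsep i j hij) v
  have h2 := mul_le_mul_of_nonneg_left h1 (show 0 ≤ (δ ^ d)⁻¹ by positivity)
  rw [kernelMatrix_dotProduct]
  refine le_trans (le_of_eq ?_) (h2.trans (le_of_eq ?_))
  · rw [div_pow, mul_inv]
    simp only [dotProduct, sq]
    field_simp
  · simp only [Finset.mul_sum, scaledKernel, smul_sub]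
    refine Finset.sum_congr rfl fun i _ => Finset.sum_congr rfl fun j _ => by ring

theorem kernelMatrix_dotProduct_le (hd : 1 ≤ d) (h : IsAdmissibleKernel d τ cΦ CΦ Φ) (hq : 0 < q)
    (hsep : ∀ i j, i ≠ j → 2 * q ≤ ‖x i - x j‖) (hδ : 0 < δ) (hδq : δ ≤ ν * cq * q)
    (v : Fin n → ℝ) :
    v ⬝ᵥ kernelMatrix Φ δ x *ᵥ v ≤ (1 + ν * cq) ^ d * ((δ ^ d)⁻¹ * Φ 0) * (v ⬝ᵥ v) := by
  have h1 := abs_sum_le_of_row_sum_le (G := fun i j => scaledKernel Φ δ (x i - x j))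
    (fun i j => by rw [← h.scaledKernel_neg, neg_sub])
    (fun i => h.sum_abs_scaledKernel_le hd hq hsep hδ hδq (x i)) v
  rw [kernelMatrix_dotProduct]
  refine (le_abs_self _).trans (h1.trans (le_of_eq ?_))
  simp only [dotProduct, sq]

theorem isUnit_det_kernelMatrix (hd : 1 ≤ d) (h : IsAdmissibleKernel d τ cΦ CΦ Φ) (hq : 0 < q)
    (hsep : ∀ i j, i ≠ j → 2 * q ≤ ‖x i - x j‖) (hδ : 0 < δ) (hδq : δ ≤ ν * cq * q) :
    IsUnit (kernelMatrix Φ δ x).det := by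
  have hK := constK_pos (d := d) (τ := τ) (ν := ν) (cq := cq) h.lower_pos
  exact isUnit_det_of_coercive (by positivity)
    (h.le_kernelMatrix_dotProduct hd hq hsep hδ hδq)

theorem inv_kernelMatrix_of_lt (hd : 1 ≤ d) (h : IsAdmissibleKernel d τ cΦ CΦ Φ)
    (hsep : ∀ i j, i ≠ j → 2 * q ≤ ‖x i - x j‖) (hδ : 0 < δ) (hlt : δ < 2 * q) :
    (kernelMatrix Φ δ x)⁻¹ = (δ ^ d / Φ 0) • 1 := by
  have hΦ0 := h.apply_zero_pos hd
  refine inv_eq_right_inv ?_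
  have : kernelMatrix Φ δ x = ((δ ^ d)⁻¹ * Φ 0) • 1 := by
    ext i j
    simp only [kernelMatrix, of_apply, Matrix.smul_apply, smul_eq_mul]
    by_cases hij : i = j
    · subst hij
      simp [scaledKernel]
    · rw [h.scaledKernel_eq_zero hδ (hlt.trans_le (hsep i j hij)), one_apply_ne hij, mul_zero]
  rw [this, smul_mul_smul_comm, one_mul]
  have : (δ ^ d)⁻¹ * Φ 0 * (δ ^ d / Φ 0) = 1 := by field_simp
  rw [this, one_smul]

theorem abs_inv_kernelMatrix_le_of_lt (hd : 1 ≤ d) (h : IsAdmissibleKernel d τ cΦ CΦ Φ)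
    (hq : 0 < q) (hsep : ∀ i j, i ≠ j → 2 * q ≤ ‖x i - x j‖) (hδ : 0 < δ)
    (hδq : δ ≤ ν * cq * q) (hlt : δ < 2 * q) (θ : ℝ) (i j : Fin n) :
    |(kernelMatrix Φ δ x)⁻¹ i j|
      ≤ constK d τ cΦ ν cq * q ^ d * Real.exp (-θ * ‖x i - x j‖ / q) := by
  have hK := constK_pos (d := d) (τ := τ) (ν := ν) (cq := cq) h.lower_pos
  have hΦ0 := h.apply_zero_pos hd
  rw [h.inv_kernelMatrix_of_lt hd hsep hδ hlt, Matrix.smul_apply, smul_eq_mul]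
  by_cases hij : i = j
  · subst hij
    have h1 := h.pow_le_apply_zero_mul_constK hd (t := δ / q) (ν := ν) (cq := cq) (by positivity)
      (by rwa [div_le_iff₀ hq])
    rw [div_pow, div_le_iff₀ (by positivity)] at h1
    rw [one_apply_eq, mul_one, abs_of_pos (by positivity), sub_self, norm_zero, mul_zero, zero_div,
      Real.exp_zero, mul_one, div_le_iff₀ hΦ0]
    linarith
  · rw [one_apply_ne hij, mul_zero, abs_zero]
    positivity

/-- Here the Lagrange function is one normalized kernel, bounded by `1` and vanishing beyond
distance `δ ≤ ν c_q q`, within which the right side is at least `1`. -/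
theorem abs_lagrangeFunction_le_of_lt (hd : 1 ≤ d) (h : IsAdmissibleKernel d τ cΦ CΦ Φ)
    (hq : 0 < q) (hsep : ∀ i j, i ≠ j → 2 * q ≤ ‖x i - x j‖) (hδ : 0 < δ)
    (hδq : δ ≤ ν * cq * q) (hlt : δ < 2 * q) {θ : ℝ} (hθ : 0 < θ) (i : Fin n) (y : E d) :
    |lagrangeFunction Φ δ x i y| ≤ Real.exp (cq * ν * θ) * Real.exp (-θ * ‖x i - y‖ / q) := by
  have hΦ0 := h.apply_zero_pos hd
  have h1 : lagrangeFunction Φ δ x i y = δ ^ d / Φ 0 * scaledKernel Φ δ (y - x i) := by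
    rw [lagrangeFunction, h.inv_kernelMatrix_of_lt hd hsep hδ hlt]
    simp only [Matrix.smul_apply, smul_eq_mul, one_apply, mul_ite, mul_one, mul_zero, ite_mul, zero_mul,
      Finset.sum_ite_eq, Finset.mem_univ, if_true]
  rw [h1]
  by_cases hy : δ < ‖y - x i‖
  · rw [h.scaledKernel_eq_zero hδ hy, mul_zero, abs_zero]
    positivity
  · rw [abs_mul, abs_of_pos (by positivity)]
    have h2 : δ ^ d / Φ 0 * |scaledKernel Φ δ (y - x i)| ≤ 1 := by
      calc δ ^ d / Φ 0 * |scaledKernel Φ δ (y - x i)|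
          ≤ δ ^ d / Φ 0 * ((δ ^ d)⁻¹ * Φ 0) := by
            gcongr; exact h.abs_scaledKernel_le hδ _
        _ = 1 := by field_simp
    refine h2.trans ?_
    rw [← Real.exp_add, Real.one_le_exp_iff, norm_sub_rev]
    have h3 : ‖y - x i‖ / q ≤ cq * ν := by rw [div_le_iff₀ hq]; linarith
    have h4 := mul_le_mul_of_nonneg_left h3 hθ.le
    rw [mul_div_assoc]
    linarith

theorem abs_inv_kernelMatrix_le (hd : 1 ≤ d) (h : IsAdmissibleKernel d τ cΦ CΦ Φ) {b : ℝ}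
    (hb : Φ 0 ≤ b) (hν : 0 < ν) (hq : 0 < q) (hsep : ∀ i j, i ≠ j → 2 * q ≤ ‖x i - x j‖)
    (hqδ : ν * q ≤ δ) (hδq : δ ≤ ν * cq * q) {κ : ℝ} (hκ : 1 < κ)
    (hκb : constK d τ cΦ ν cq * b * (1 + ν * cq) ^ d / ν ^ d ≤ κ) (i j : Fin n) :
    |(kernelMatrix Φ δ x)⁻¹ i j| ≤ constK d τ cΦ ν cq * q ^ d
      * Real.exp (-(-Real.log (1 - κ⁻¹) / (ν * cq)) * ‖x i - x j‖ / q) := by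
  have hK := constK_pos (d := d) (τ := τ) (ν := ν) (cq := cq) h.lower_pos
  have hδ : 0 < δ := lt_of_lt_of_le (by positivity) hqδ
  have hνq : 0 < ν * cq := pos_of_mul_pos_left (hδ.trans_le hδq) hq.le
  have hΦ0 := h.apply_zero_pos hd
  set K := constK d τ cΦ ν cq with hKdef
  set lam := (K * q ^ d)⁻¹ with hlam
  have hlam0 : 0 < lam := by positivity
  -- Using `Φ(0) ≤ b` and `δ ≥ νq` makes the ratio of the spectral bounds independent of `Φ` and of
  -- the level.
  have hupper : (1 + ν * cq) ^ d * ((δ ^ d)⁻¹ * Φ 0) ≤ κ * lam := by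
    have h1 : (δ ^ d)⁻¹ ≤ ((ν * q) ^ d)⁻¹ := by gcongr
    calc (1 + ν * cq) ^ d * ((δ ^ d)⁻¹ * Φ 0) ≤ (1 + ν * cq) ^ d * (((ν * q) ^ d)⁻¹ * b) := by
          gcongr
      _ = K * b * (1 + ν * cq) ^ d / ν ^ d * lam := by
          rw [hlam, mul_pow]; field_simp
      _ ≤ κ * lam := by gcongr
  have hdec := abs_inv_apply_le_of_band (h.kernelMatrix_isSymm δ x) hlam0
    (show lam < κ * lam by nlinarith) (h.le_kernelMatrix_dotProduct hd hq hsep hδ hδq)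
    (fun v => (h.kernelMatrix_dotProduct_le hd hq hsep hδ hδq v).trans
      (mul_le_mul_of_nonneg_right hupper (zero_le_dotProduct_self v))) hδ
    (fun i j hij => h.scaledKernel_eq_zero hδ hij) i j
  have h2 : lam / (κ * lam) = κ⁻¹ := by field_simp
  have hκ1 : κ⁻¹ < 1 := inv_lt_one_of_one_lt₀ hκ
  have hκ0 : 0 < κ⁻¹ := by positivity
  rw [h2, hlam, inv_inv] at hdec
  refine hdec.trans ?_
  gcongr
  rw [Real.rpow_def_of_pos (by linarith)]
  refine Real.exp_le_exp.2 ?_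
  -- The logarithm is nonpositive, so replacing `δ` by the larger `ν c_q q` only weakens the bound.
  have hlog : Real.log (1 - κ⁻¹) ≤ 0 := Real.log_nonpos (by linarith) (by linarith)
  have h3 : ‖x i - x j‖ / (ν * cq * q) ≤ ‖x i - x j‖ / δ := by gcongr
  have h4 := mul_le_mul_of_nonpos_left h3 hlog
  refine h4.trans (le_of_eq ?_)
  field_simp

/-- Only nodes within `δ` of `y` contribute, and moving the exponential from `x_k` to `y` costs
`e^(c_q ν θ)`. The hypothesis `q ≤ δ` absorbs `q^d δ^(-d)`. -/
theorem abs_lagrangeFunction_le (hd : 1 ≤ d) (h : IsAdmissibleKernel d τ cΦ CΦ Φ)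
    (hq : 0 < q) (hsep : ∀ i j, i ≠ j → 2 * q ≤ ‖x i - x j‖) (hle : q ≤ δ)
    (hδq : δ ≤ ν * cq * q) {θ : ℝ} (hθ : 0 < θ)
    (hinv : ∀ i j, |(kernelMatrix Φ δ x)⁻¹ i j|
      ≤ constK d τ cΦ ν cq * q ^ d * Real.exp (-θ * ‖x i - x j‖ / q)) (i : Fin n) (y : E d) :
    |lagrangeFunction Φ δ x i y| ≤ Φ 0 * constK d τ cΦ ν cq * Real.exp (cq * ν * θ)
      * (1 + ν * cq) ^ d * Real.exp (-θ * ‖x i - y‖ / q) := by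
  have hK := constK_pos (d := d) (τ := τ) (ν := ν) (cq := cq) h.lower_pos
  have hδ : 0 < δ := hq.trans_le hle
  have hνq : 0 < ν * cq := pos_of_mul_pos_left (hδ.trans_le hδq) hq.le
  have hΦ0 := h.apply_zero_pos hd
  set K := constK d τ cΦ ν cq with hKdef
  set D := Real.exp (cq * ν * θ) * Real.exp (-θ * ‖x i - y‖ / q) with hD
  have hterm : ∀ k, |(kernelMatrix Φ δ x)⁻¹ i k * scaledKernel Φ δ (y - x k)|
      ≤ K * q ^ d * D * |scaledKernel Φ δ (y - x k)| := by
    intro k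
    by_cases hk : δ < ‖y - x k‖
    · simp [h.scaledKernel_eq_zero hδ hk]
    · rw [abs_mul]
      gcongr
      refine (hinv i k).trans ?_
      rw [hD, ← Real.exp_add]
      gcongr
      have h1 : ‖x i - y‖ ≤ ‖x i - x k‖ + ‖y - x k‖ := by
        rw [norm_sub_rev y]; exact norm_sub_le_norm_sub_add_norm_sub _ _ _
      have h2 : ‖x i - y‖ / q ≤ ‖x i - x k‖ / q + cq * ν := by
        rw [← sub_le_iff_le_add', ← sub_div, div_le_iff₀ hq]
        linarith
      have h3 := mul_le_mul_of_nonneg_left h2 hθ.le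
      rw [mul_div_assoc, mul_div_assoc]
      linarith
  have hqd : q ^ d * (δ ^ d)⁻¹ ≤ 1 := by
    rw [← div_eq_mul_inv, div_le_one (by positivity)]
    gcongr
  calc |lagrangeFunction Φ δ x i y|
      ≤ ∑ k, K * q ^ d * D * |scaledKernel Φ δ (y - x k)| :=
        (Finset.abs_sum_le_sum_abs _ _).trans (Finset.sum_le_sum fun k _ => hterm k)
    _ ≤ K * q ^ d * D * ((1 + ν * cq) ^ d * ((δ ^ d)⁻¹ * Φ 0)) := by
        rw [← Finset.mul_sum]
        gcongr
        exact h.sum_abs_scaledKernel_le hd hq hsep hδ hδq y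
    _ = (Φ 0 * K * D * (1 + ν * cq) ^ d) * (q ^ d * (δ ^ d)⁻¹) := by ring
    _ ≤ (Φ 0 * K * D * (1 + ν * cq) ^ d) * 1 := by gcongr
    _ = _ := by rw [hD]; ring

end IsAdmissibleKernel

end MultiscaleKernel

/-! ### Choice of the rate and conclusion -/

namespace MultiscaleKernel

namespace IsAdmissibleKernel

variable {d : ℕ} {τ cΦ CΦ ν cq : ℝ} {Φ : E d → ℝ}

/-- The decay estimates for one point set, for an explicit rate `θ`. -/
theorem decay_estimates (hd : 1 ≤ d) (h : IsAdmissibleKernel d τ cΦ CΦ Φ) {b : ℝ} (hb : Φ 0 ≤ b)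
    {n : ℕ} {x : Fin n → E d} {q δ : ℝ} (hν : 0 < ν) (hcq : 1 ≤ cq) (hq : 0 < q)
    (hsep : ∀ i j, i ≠ j → 2 * q ≤ ‖x i - x j‖) (hqδ : ν * q ≤ δ) (hδq : δ ≤ ν * cq * q)
    {κ θ : ℝ} (hκ : 1 < κ) (hκb : constK d τ cΦ ν cq * b * (1 + ν * cq) ^ d / ν ^ d ≤ κ)
    (hθ : θ = if 1 ≤ ν * cq then -Real.log (1 - κ⁻¹) / (ν * cq) else d * |Real.log ν| + 1)
    (hθ0 : 0 < θ) :
    (∀ i j, |(kernelMatrix Φ δ x)⁻¹ i j|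
      ≤ constK d τ cΦ ν cq * q ^ d * Real.exp (-θ * ‖x i - x j‖ / q)) ∧
    ∀ i y, |lagrangeFunction Φ δ x i y|
      ≤ Φ 0 * constK d τ cΦ ν cq * Real.exp (2 * θ * √(d : ℝ)) * Real.exp (cq * ν * θ)
        * (1 + ν * cq) ^ d * Real.exp (-θ * ‖x i - y‖ / q) := by
  have hδ : 0 < δ := lt_of_lt_of_le (by positivity) hqδ
  have hK := constK_pos (d := d) (τ := τ) (ν := ν) (cq := cq) h.lower_pos
  have hΦ0 := h.apply_zero_pos hd
  have hνq : 0 < ν * cq := by positivity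
  have hd1 : (1 : ℝ) ≤ √(d : ℝ) := by rw [Real.one_le_sqrt]; exact_mod_cast hd
  have hpow : (1 : ℝ) ≤ (1 + ν * cq) ^ d := one_le_pow₀ (by linarith)
  have hexp : 1 ≤ Real.exp (2 * θ * √(d : ℝ)) := Real.one_le_exp (by positivity)
  have hK1 := h.pow_le_apply_zero_mul_constK hd hνq le_rfl
  have hdiag : 1 ≤ Φ 0 * constK d τ cΦ ν cq * Real.exp (2 * θ * √(d : ℝ)) → δ < 2 * q →
      ∀ i y, |lagrangeFunction Φ δ x i y|
        ≤ Φ 0 * constK d τ cΦ ν cq * Real.exp (2 * θ * √(d : ℝ)) * Real.exp (cq * ν * θ)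
          * (1 + ν * cq) ^ d * Real.exp (-θ * ‖x i - y‖ / q) := by
    intro h1 hlt i y
    refine (h.abs_lagrangeFunction_le_of_lt hd hq hsep hδ hδq hlt hθ0 i y).trans ?_
    gcongr
    calc Real.exp (cq * ν * θ) = 1 * Real.exp (cq * ν * θ) * 1 := by ring
      _ ≤ _ := by gcongr
  split_ifs at hθ with hcase
  · have hinv : ∀ i j, |(kernelMatrix Φ δ x)⁻¹ i j|
        ≤ constK d τ cΦ ν cq * q ^ d * Real.exp (-θ * ‖x i - x j‖ / q) := by
      rw [hθ]
      exact h.abs_inv_kernelMatrix_le hd hb hν hq hsep hqδ hδq hκ hκb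
    refine ⟨hinv, ?_⟩
    -- For `δ < q` the factor `q^d δ^(-d)` exceeds `1`, but then the matrix is scalar and `Φ(0) K ≥
    -- (ν c_q)^d ≥ 1`.
    rcases lt_or_ge δ q with hlt | hle
    · refine hdiag ?_ (by linarith)
      have h2 : (1 : ℝ) ≤ (ν * cq) ^ d := one_le_pow₀ hcase
      exact one_le_mul_of_one_le_of_one_le (h2.trans hK1) hexp
    · intro i y
      refine (h.abs_lagrangeFunction_le hd hq hsep hle hδq hθ0 hinv i y).trans ?_
      gcongr ?_ * Real.exp (cq * ν * θ) * _ * _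
      exact le_mul_of_one_le_right (by positivity) hexp
  · have hlt : δ < 2 * q := by
      have := not_le.1 hcase
      nlinarith
    refine ⟨h.abs_inv_kernelMatrix_le_of_lt hd hq hsep hδ hδq hlt θ, hdiag ?_ hlt⟩
    have h2 : ν ^ d ≤ (ν * cq) ^ d := by
      gcongr
      exact le_mul_of_one_le_right hν.le hcq
    -- Here `Φ(0) K` may be below `1`; the rate `d |log ν| + 1` is chosen so that `e^(2θ√d)`
    -- compensates `ν^d`.
    have h3 : 1 ≤ ν ^ d * Real.exp (2 * θ * √(d : ℝ)) := by
      have h4 : ν ^ d = Real.exp (d * Real.log ν) := by rw [Real.exp_nat_mul, Real.exp_log hν]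
      rw [h4, ← Real.exp_add, Real.one_le_exp_iff]
      have h5 : θ * 1 ≤ θ * √(d : ℝ) := by gcongr
      have h6 := mul_le_mul_of_nonneg_left (neg_abs_le (Real.log ν)) (Nat.cast_nonneg (α := ℝ) d)
      linarith
    exact h3.trans (by gcongr; exact h2.trans hK1)

end IsAdmissibleKernel

end MultiscaleKernel

theorem lemma3p2 (d : ℕ) (hd : 1 ≤ d) (τ cΦ ν cq b : ℝ)
    (hτ : (d : ℝ) / 2 < τ) (hcΦ : 0 < cΦ) (hν : 0 < ν) :
    ∃ θ : ℝ, 0 < θ ∧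
      ∀ (CΦ : ℝ) (Φ : MultiscaleKernel.E d → ℝ),
        MultiscaleKernel.IsAdmissibleKernel d τ cΦ CΦ Φ → Φ 0 ≤ b →
      ∀ Ω : Set (MultiscaleKernel.E d), Bornology.IsBounded Ω → (interior Ω).Nonempty →
      ∀ (L : ℕ) (N : ℕ → ℕ) (x : (ℓ : ℕ) → Fin (N ℓ) → MultiscaleKernel.E d),
        (∀ ℓ, 1 ≤ ℓ → ℓ ≤ L →
          Function.Injective (x ℓ) ∧ Set.range (x ℓ) ⊆ Ω ∧
          MultiscaleKernel.separationDistance (Set.range (x ℓ))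
            ≤ MultiscaleKernel.fillDistance Ω (Set.range (x ℓ)) ∧
          MultiscaleKernel.fillDistance Ω (Set.range (x ℓ))
            ≤ cq * MultiscaleKernel.separationDistance (Set.range (x ℓ))) →
      ∀ ℓ, 1 ≤ ℓ → ℓ ≤ L →
      ∀ q δ : ℝ, q = MultiscaleKernel.separationDistance (Set.range (x ℓ)) →
        δ = ν * MultiscaleKernel.fillDistance Ω (Set.range (x ℓ)) →
        IsUnit (MultiscaleKernel.kernelMatrix Φ δ (x ℓ)).det ∧
        (∀ i j : Fin (N ℓ),
          |(MultiscaleKernel.kernelMatrix Φ δ (x ℓ))⁻¹ i j|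
            ≤ 2 * MultiscaleKernel.constK d τ cΦ ν cq * Real.exp (2 * θ * √(d : ℝ)) * q ^ d
              * Real.exp (-θ * ‖x ℓ i - x ℓ j‖ / q)) ∧
        (∀ (i : Fin (N ℓ)) (y : MultiscaleKernel.E d),
          |MultiscaleKernel.lagrangeFunction Φ δ (x ℓ) i y|
            ≤ 2 * Φ 0 * MultiscaleKernel.constK d τ cΦ ν cq * Real.exp (2 * θ * √(d : ℝ))
              * Real.exp (cq * ν * θ) * (1 + ν * cq) ^ d
              * Real.exp (-θ * ‖x ℓ i - y‖ / q)) := by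
  classical
  set K := MultiscaleKernel.constK d τ cΦ ν cq with hK
  -- The maximum with `2` keeps `1 - κ⁻¹` strictly between `0` and `1`, so its logarithm is
  -- negative.
  set κ := max 2 (K * b * (1 + ν * cq) ^ d / ν ^ d) with hκdef
  have hκ2 : 2 ≤ κ := le_max_left _ _
  have hκ0 : 0 < κ⁻¹ := inv_pos.2 (by linarith)
  have hκ1 : κ⁻¹ < 1 := inv_lt_one_of_one_lt₀ (by linarith)
  -- If `ν c_q < 1` then `δ < q`, the matrix is scalar, and any positive rate works for the inverse;
  -- the second value serves the Lagrange bound.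
  set θ := if 1 ≤ ν * cq then -Real.log (1 - κ⁻¹) / (ν * cq) else d * |Real.log ν| + 1 with hθ
  have hθ0 : 0 < θ := by
    rw [hθ]
    split_ifs with h
    · exact div_pos (neg_pos.2 (Real.log_neg (by linarith) (by linarith))) (by linarith)
    · positivity
  refine ⟨θ, hθ0, fun CΦ Φ hΦ hb Ω hΩb hΩ L N x hx ℓ hℓ hℓL q δ hq hδ => ?_⟩
  obtain ⟨hinj, -, hqh, hhq⟩ := hx ℓ hℓ hℓL
  rcases isEmpty_or_nonempty (Fin (N ℓ)) with hempty | ⟨⟨i₀⟩⟩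
  · exact ⟨by rw [Matrix.det_isEmpty]; exact isUnit_one, fun i => hempty.elim i,
      fun i => hempty.elim i⟩
  have hq0 : 0 < q := hq ▸ MultiscaleKernel.separationDistance_pos hd hΩb hΩ i₀ hhq
  have hsep : ∀ i j, i ≠ j → 2 * q ≤ ‖x ℓ i - x ℓ j‖ := fun i j hij =>
    hq ▸ MultiscaleKernel.two_mul_separationDistance_le hinj hij
  rw [← hq] at hqh hhq
  -- From `q ≤ h ≤ c_q q` and `q > 0`.
  have hcq : 1 ≤ cq := by
    by_contra hlt
    nlinarith
  have hqδ : ν * q ≤ δ := by rw [hδ]; gcongr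
  have hδq : δ ≤ ν * cq * q := by rw [hδ, mul_assoc]; gcongr
  have hK0 : 0 < K := MultiscaleKernel.constK_pos hcΦ
  have hΦ0 := hΦ.apply_zero_pos hd
  obtain ⟨h1, h2⟩ := hΦ.decay_estimates hd hb hν hcq hq0 hsep hqδ hδq (by linarith)
    (le_max_right _ _) hθ hθ0
  have hexp : 1 ≤ Real.exp (2 * θ * √(d : ℝ)) := Real.one_le_exp (by positivity)
  refine ⟨hΦ.isUnit_det_kernelMatrix hd hq0 hsep (lt_of_lt_of_le (by positivity) hqδ) hδq,
    fun i j => (h1 i j).trans ?_, fun i y => (h2 i y).trans ?_⟩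
  · have h3 : K ≤ 2 * K * Real.exp (2 * θ * √(d : ℝ)) := by nlinarith
    gcongr
  · gcongr
    linarith
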